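/- Let $a>0$, $\mu>0$. Let $A_1,A_2,\dots$ be i.i.d. positive interarrival times with distribution $F$ having a density, with Laplace--Stieltjes transform $\phi(s)=\int_0^\infty e^{-st}\,dF(t)$, and let $C_1,C_2,\dots$ be i.i.d. exponential with mean $1/\mu$, independent of the $A_i$. Put $T_0=0$, $T_n=A_1+\dots+A_n$, $N(t)=\#\{n\ge1:T_n\le t\}$. For an initial surplus $x>0$ let $$U(t)=x-t+\sum_{i=1}^{N(t)}\bigl(C_i+a\,U(T_i-)\bigr),\quad t\ge 0,\qquad \tau_x=\inf\{t\ge0:U(t)=0\}\in[0,\infty].$$ For $\alpha\ge0$ and complex $s$ with $\operatorname{Re}s>0$ let $$\tau(s,\alpha)=\int_0^\infty e^{-sx}\,\mathbb E\bigl[e^{-\alpha\tau_x}\bigr]\,dx,$$ where $e^{-\alpha\tau_x}:=0$ on $\{\tau_x=\infty\}$ (also for $\alpha=0$), and let $$J_1(s,\alpha)=\phi(s+\alpha)\frac{\mu}{\mu(1+a)-s},\qquad H_1(s,\alpha)=\frac{1-\phi(s+\alpha)}{s+\alpha}-\phi(s+\alpha)\frac{\mu}{\mu(1+a)-s}\,\tau(\mu,\alpha).$$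 Then, for every $\alpha\ge 0$, the expectations and integrals above converge absolutely, and for every $s$ with $\operatorname{Re}s>0$ and $s\notin\{\mu(1+a)^{j+1}:j=0,1,\dots\}$, $$\tau(s,\alpha)=\sum_{k=0}^\infty\ \prod_{j=0}^{k-1}J_1\!\left(\frac{s}{(1+a)^j},\alpha\right)H_1\!\left(\frac{s}{(1+a)^k},\alpha\right),$$ the series converging absolutely (an empty product is $1$); the excluded points are removable singularities of the right-hand side, which tends to $\tau(\mu(1+a)^{j+1},\alpha)$ as $s\to\mu(1+a)^{j+1}$. Moreover $$\tau(\mu,\alpha)=\frac{\displaystyle\sum_{k=0}^\infty\Bigl(\prod_{j=0}^{k-1}J_1\bigl(\tfrac{\mu}{(1+a)^j},\alpha\bigr)\Bigr)\frac{1-\phi\bigl(\frac{\mu}{(1+a)^k}+\alpha\bigr)}{\frac{\mu}{(1+a)^k}+\alpha}}{\displaystyle1+\sum_{k=0}^\infty\Bigl(\prod_{j=0}^{k-1}J_1\bigl(\tfrac{\mu}{(1+a)^j},\alpha\bigr)\Bigr)\phi\bigl(\tfrac{\mu}{(1+a)^k}+\alpha\bigr)\frac{(1+a)^k}{(1+a)^{k+1}-1}},$$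 where both series converge absolutely and the denominator is nonzero. -/

import Mathlib

open MeasureTheory ProbabilityTheory Filter Topology
open scoped ENNReal

noncomputable section

namespace DualRisk

/-! ### A single path

A path of the model is given by its interarrival times `g 0, g 1, …` and its additive gains
`c 0, c 1, …`.  The gain number `n + 1` of the usual numbering has index `n` here: it arrives at
time `arrival g (n + 1)` and its additive part is `c n`. -/

/-- The arrival epochs: `arrival g 0 = 0`, and `arrival g n` is the time of the `n`th gain. -/
def arrival (g : ℕ → ℝ) (n : ℕ) : ℝ := ∑ i ∈ Finset.range n, g i

/-- The counting process: the number of gains that arrive up to and including time `t`. -/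
def count (g : ℕ → ℝ) (t : ℝ) : ℕ := Set.ncard {n : ℕ | arrival g (n + 1) ≤ t}

/-- The surplus just before the gain with index `n` arrives, when the initial surplus is `x`: the
surplus `u` before a gain becomes `(1 + a) * u + c` after it and then decreases at rate `1`. -/
def preJump (a x : ℝ) (g c : ℕ → ℝ) : ℕ → ℝ
  | 0 => x - g 0
  | n + 1 => ((1 + a) * preJump a x g c n + c n) - g (n + 1)

/-- The surplus at time `t`: the initial surplus `x`, minus the expenses `t`, plus the gains up to
time `t`; the gain with index `i` is `c i` plus `a` times the surplus just before it. -/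
def surplus (a x : ℝ) (g c : ℕ → ℝ) (t : ℝ) : ℝ :=
  x - t + ∑ i ∈ Finset.range (count g t), (c i + a * preJump a x g c i)

/-- `preJump` is indeed the left limit of the surplus process at the arrival epochs. -/
theorem tendsto_surplus_preJump (a x : ℝ) (g c : ℕ → ℝ) (hg : ∀ i, 0 < g i) (n : ℕ) :
    Tendsto (surplus a x g c) (𝓝[<] (arrival g (n + 1))) (𝓝 (preJump a x g c n)) := by
  have hmono : StrictMono (arrival g) := by
    refine strictMono_nat_of_lt_succ fun k => ?_
    have h : arrival g (k + 1) = arrival g k + g k := Finset.sum_range_succ g k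
    have := hg k
    linarith
  have hpre : ∀ m, preJump a x g c m = x - arrival g (m + 1)
      + ∑ i ∈ Finset.range m, (c i + a * preJump a x g c i) := by
    intro m
    induction m with
    | zero => simp [preJump, arrival]
    | succ m ih =>
      have h : arrival g (m + 1 + 1) = arrival g (m + 1) + g (m + 1) :=
        Finset.sum_range_succ g (m + 1)
      rw [Finset.sum_range_succ, h]
      simp only [preJump]
      linarith
  have hcount : ∀ t ∈ Set.Ico (arrival g n) (arrival g (n + 1)), count g t = n := by
    intro t ht
    have hset : {k : ℕ | arrival g (k + 1) ≤ t} = ↑(Finset.range n) := by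
      ext k
      simp only [Set.mem_ofPred_eq, Finset.coe_range, Set.mem_Iio]
      constructor
      · intro hk
        have := hmono.lt_iff_lt.1 (lt_of_le_of_lt hk ht.2)
        omega
      · intro hk
        exact (hmono.monotone (Nat.succ_le_of_lt hk)).trans ht.1
    rw [count, hset, Set.ncard_coe_finset, Finset.card_range]
  have hev : ∀ᶠ t in 𝓝[<] (arrival g (n + 1)),
      x - t + ∑ i ∈ Finset.range n, (c i + a * preJump a x g c i) = surplus a x g c t := by
    filter_upwards [Ico_mem_nhdsLT (hmono (Nat.lt_succ_self n))] with t ht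
    rw [surplus, hcount t ht]
  refine Tendsto.congr' hev ?_
  rw [hpre n]
  exact ((tendsto_const_nhds.sub tendsto_id).add tendsto_const_nhds).mono_left nhdsWithin_le_nhds

/-- The time to ruin `inf {t ≥ 0 | U(t) = 0}`, which is `∞` if the surplus never equals `0`. -/
def ruinTime (a x : ℝ) (g c : ℕ → ℝ) : ℝ≥0∞ :=
  ⨅ (t : ℝ) (_ : 0 ≤ t ∧ surplus a x g c t = 0), ENNReal.ofReal t

/-- The discount factor `exp (-α T)` of a time `T` in `[0, ∞]`; it is `0` for `T = ∞`. -/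
def discount (α : ℝ) (T : ℝ≥0∞) : ℝ := if T = ∞ then 0 else Real.exp (-α * T.toReal)

/-! ### The transforms -/

/-- The random variable `exp (-α τ_x)`, where `τ_x` is the time to ruin from initial surplus `x`,
the interarrival times are the `A i` and the additive gains are the `C i`. -/
def discountedRuin {Ω : Type*} (a : ℝ) (A C : ℕ → Ω → ℝ) (α x : ℝ) (ω : Ω) : ℝ :=
  discount α (ruinTime a x (fun i => A i ω) (fun i => C i ω))

/-- The double transform `τ(s, α) = ∫_0^∞ exp (-s x) E[exp (-α τ_x)] dx`. -/
def tau {Ω : Type*} [MeasurableSpace Ω] (P : Measure Ω) (a : ℝ) (A C : ℕ → Ω → ℝ)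
    (s : ℂ) (α : ℝ) : ℂ :=
  ∫ x in Set.Ioi (0 : ℝ), Complex.exp (-s * x) * ((∫ ω, discountedRuin a A C α x ω ∂P : ℝ) : ℂ)

/-- The Laplace-Stieltjes transform `φ(s) = ∫ exp (-s t) dF(t)`. -/
def lst (F : Measure ℝ) (s : ℂ) : ℂ := ∫ t, Complex.exp (-s * t) ∂F

/-- `J₁(s, α) = φ(s + α) μ / (μ (1 + a) - s)`. -/
def J₁ (F : Measure ℝ) (a mu : ℝ) (s : ℂ) (α : ℝ) : ℂ :=
  lst F (s + α) * (mu / (mu * (1 + a) - s))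

/-- `H₁(s, α) = (1 - φ(s + α)) / (s + α) - φ(s + α) μ / (μ (1 + a) - s) τ(μ, α)`, where the
number `τ(μ, α)` is the argument `m`. -/
def H₁ (F : Measure ℝ) (a mu : ℝ) (m : ℂ) (s : ℂ) (α : ℝ) : ℂ :=
  (1 - lst F (s + α)) / (s + α) - lst F (s + α) * (mu / (mu * (1 + a) - s)) * m

/-- The product `∏_{j < k} J₁(s / (1 + a)^j, α)`. -/
def prodJ₁ (F : Measure ℝ) (a mu : ℝ) (s : ℂ) (α : ℝ) (k : ℕ) : ℂ :=
  ∏ j ∈ Finset.range k, J₁ F a mu (s / (1 + a) ^ j) α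

/-- The `k`th term `∏_{j < k} J₁(s / (1 + a)^j, α) H₁(s / (1 + a)^k, α)` of the series for
`τ(s, α)`, with `m = τ(μ, α)`. -/
def seriesTerm (F : Measure ℝ) (a mu : ℝ) (m : ℂ) (s : ℂ) (α : ℝ) (k : ℕ) : ℂ :=
  prodJ₁ F a mu s α k * H₁ F a mu m (s / (1 + a) ^ k) α

/-- The `k`th term of the series in the numerator of the formula for `τ(μ, α)`. -/
def numTerm (F : Measure ℝ) (a mu α : ℝ) (k : ℕ) : ℂ :=
  prodJ₁ F a mu mu α k
    * ((1 - lst F ((mu : ℂ) / (1 + a) ^ k + α)) / ((mu : ℂ) / (1 + a) ^ k + α))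

/-- The `k`th term of the series in the denominator of the formula for `τ(μ, α)`. -/
def denTerm (F : Measure ℝ) (a mu α : ℝ) (k : ℕ) : ℂ :=
  prodJ₁ F a mu mu α k * lst F ((mu : ℂ) / (1 + a) ^ k + α)
    * ((1 + a : ℂ) ^ k / ((1 + a : ℂ) ^ (k + 1) - 1))

end DualRisk

end

noncomputable section

namespace DualRisk

/-! ### Renewal of a path at its first gain -/

/-! Condition on the first gain. If it comes after time `x`, ruin occurs at `x`; otherwise the
process restarts at its arrival from the surplus `(1 + a) * (x - A) + C`. This gives a renewal
equation for `f x = E[exp (-α τ_x)]` (`ruinTransform_renewal`). Taking Laplace transforms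
(`laplace_renewal`, `laplace_exponential`) turns it into `τ(s) = H₁(s) + J₁(s) τ(s / (1 + a))`
(`laplace_ruinTransform`); the exponential law of `C` is what produces the constant `τ(μ)` in `H₁`.
Iterating `n` times gives the `n`th partial sum of the series, up to the remainder `∏_{j<n} J₁(s /
(1 + a)^j) · τ(s / (1 + a)^n)` (`sum_seriesTerm`).

The difficulty is the remainder. The rational factors of the product decay like `(1 + a)^(-n)`, but
the trivial bound `|τ(s)| ≤ 1 / Re s` grows like `(1 + a)^n`, so the two only balance. What decides
is `Φ n = ∏_{j<n} φ(Re s / (1 + a)^j)`, which also bounds the transform factors. If `Φ n → 0`, the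
remainder vanishes. If `Φ` has a positive limit, the discounted sum of the `A i / (1 + a)^i` is
finite with high probability in a quantitative sense; ruin requires this sum to reach `x`, so ruin
from a large surplus is unlikely, and `s τ(s)` tends to `0` along the sequence (`ruinTransform_le`,
`tendsto_remainder`). No moment of `F` is needed.

Absolute convergence comes from the geometric decay and from the telescoping sum of `Φ n - Φ (n +
1)`. The singularities are removable because `τ` is continuous and equals the series around them. At
`s = μ` the series is a linear equation for `τ(μ)`, whose leading coefficient is `1` plus
nonnegative terms. -/

theorem arrival_zero (g : ℕ → ℝ) : arrival g 0 = 0 := by simp [arrival]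

theorem arrival_succ (g : ℕ → ℝ) (n : ℕ) :
    arrival g (n + 1) = g 0 + arrival (fun i => g (i + 1)) n := by
  rw [arrival, Finset.sum_range_succ', arrival, add_comm]

theorem strictMono_arrival {g : ℕ → ℝ} (hg : ∀ i, 0 < g i) : StrictMono (arrival g) := by
  refine strictMono_nat_of_lt_succ fun k => ?_
  have h : arrival g (k + 1) = arrival g k + g k := Finset.sum_range_succ g k
  linarith [hg k]

theorem arrival_nonneg {g : ℕ → ℝ} (hg : ∀ i, 0 < g i) (n : ℕ) : 0 ≤ arrival g n :=
  Finset.sum_nonneg fun i _ => (hg i).le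

theorem count_of_lt {g : ℕ → ℝ} (hg : ∀ i, 0 < g i) {t : ℝ} (ht : t < g 0) : count g t = 0 := by
  have : {n : ℕ | arrival g (n + 1) ≤ t} = ∅ := by
    ext n
    simp only [Set.mem_ofPred_eq, Set.mem_empty_iff_false, iff_false, not_le]
    rw [arrival_succ]
    linarith [arrival_nonneg (fun i => hg (i + 1)) n]
  rw [count, this, Set.ncard_empty]

theorem count_of_le {g : ℕ → ℝ} (hg : ∀ i, 0 < g i) (hinf : ∀ t, ∃ n, t < arrival g n) {t : ℝ}
    (ht : g 0 ≤ t) : count g t = count (fun i => g (i + 1)) (t - g 0) + 1 := by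
  set B := {n : ℕ | arrival (fun i => g (i + 1)) (n + 1) ≤ t - g 0} with hB
  have hset : {n : ℕ | arrival g (n + 1) ≤ t} = insert 0 (Nat.succ '' B) := by
    ext n
    rcases n with _ | n
    · simpa [arrival] using ht
    · simp only [Set.mem_ofPred_eq, arrival_succ g, Set.mem_insert_iff, Nat.add_eq_zero_iff,
        one_ne_zero, and_false, Set.mem_image, Nat.succ_eq_add_one, Nat.add_right_cancel_iff,
        exists_eq_right, false_or, hB]
      constructor <;> intro h <;> linarith
  -- `Set.ncard` is `0` on infinite sets, so the shift by one needs non-explosion.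
  have hfin : B.Finite := by
    obtain ⟨N, hN⟩ := hinf t
    refine (Set.finite_lt_nat N).subset fun n hn => ?_
    have h1 : arrival g (n + 2) ≤ t := by
      rw [arrival_succ]
      have : arrival (fun i => g (i + 1)) (n + 1) ≤ t - g 0 := hn
      linarith
    have := (strictMono_arrival hg).lt_iff_lt.1 (h1.trans_lt hN)
    show n < N
    omega
  rw [count, hset, Set.ncard_insert_of_notMem (by simp) (hfin.image _),
    Set.ncard_image_of_injective _ Nat.succ_injective, count]

theorem preJump_succ (a x : ℝ) (g c : ℕ → ℝ) (n : ℕ) :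
    preJump a x g c (n + 1) = preJump a ((1 + a) * (x - g 0) + c 0) (fun i => g (i + 1))
      (fun i => c (i + 1)) n := by
  induction n with
  | zero => simp [preJump]
  | succ n ih => rw [preJump, ih]; simp only [preJump]

theorem surplus_of_lt (a x : ℝ) {g : ℕ → ℝ} (c : ℕ → ℝ) (hg : ∀ i, 0 < g i) {t : ℝ}
    (ht : t < g 0) : surplus a x g c t = x - t := by
  simp [surplus, count_of_lt hg ht]

theorem surplus_of_le (a x : ℝ) {g : ℕ → ℝ} (c : ℕ → ℝ) (hg : ∀ i, 0 < g i)
    (hinf : ∀ t, ∃ n, t < arrival g n) {t : ℝ} (ht : g 0 ≤ t) :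
    surplus a x g c t = surplus a ((1 + a) * (x - g 0) + c 0) (fun i => g (i + 1))
      (fun i => c (i + 1)) (t - g 0) := by
  rw [surplus, count_of_le hg hinf ht, Finset.sum_range_succ', surplus]
  simp only [preJump_succ a x g c]
  simp only [preJump]
  ring

theorem ruinTime_of_lt (a : ℝ) {x : ℝ} {g : ℕ → ℝ} (c : ℕ → ℝ) (hg : ∀ i, 0 < g i) (hx : 0 < x)
    (hxg : x < g 0) : ruinTime a x g c = ENNReal.ofReal x := by
  refine le_antisymm (iInf₂_le x ⟨hx.le, by rw [surplus_of_lt a x c hg hxg, sub_self]⟩)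
    (le_iInf₂ fun t ht => ENNReal.ofReal_le_ofReal ?_)
  · by_contra! h
    have h2 := ht.2
    rw [surplus_of_lt a x c hg (h.trans hxg)] at h2
    linarith

/-- Before the first gain the surplus `x - t` has no zero, and from then on the path is a shifted
copy. Equality `g 0 = x` belongs here: the count includes arrivals at time `t`, so the surplus at
that instant is already `c 0`. -/
theorem ruinTime_of_le (a : ℝ) {x : ℝ} {g : ℕ → ℝ} (c : ℕ → ℝ) (hg : ∀ i, 0 < g i)
    (hinf : ∀ t, ∃ n, t < arrival g n) (hxg : g 0 ≤ x) :
    ruinTime a x g c = ENNReal.ofReal (g 0) + ruinTime a ((1 + a) * (x - g 0) + c 0)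
      (fun i => g (i + 1)) (fun i => c (i + 1)) := by
  apply le_antisymm
  · rw [← tsub_le_iff_left]
    refine le_iInf₂ fun t ht => ?_
    rw [tsub_le_iff_left, ← ENNReal.ofReal_add (hg 0).le ht.1]
    refine iInf₂_le _ ⟨by linarith [hg 0], ?_⟩
    rw [surplus_of_le a x c hg hinf (by linarith), add_sub_cancel_left]
    exact ht.2
  · refine le_iInf₂ fun t ht => ?_
    have htg : g 0 ≤ t := by
      by_contra! h
      have h2 := ht.2
      rw [surplus_of_lt a x c hg h] at h2
      linarith
    have : ENNReal.ofReal t = ENNReal.ofReal (g 0) + ENNReal.ofReal (t - g 0) := by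
      rw [← ENNReal.ofReal_add (hg 0).le (by linarith), add_sub_cancel]
    rw [this]
    gcongr
    refine iInf₂_le _ ⟨by linarith, ?_⟩
    rw [← surplus_of_le a x c hg hinf htg]
    exact ht.2

theorem discount_ofReal (α : ℝ) {t : ℝ} (ht : 0 ≤ t) :
    discount α (ENNReal.ofReal t) = Real.exp (-α * t) := by
  simp [discount, ENNReal.toReal_ofReal ht]

theorem discount_ofReal_add (α : ℝ) {t : ℝ} (ht : 0 ≤ t) (T : ℝ≥0∞) :
    discount α (ENNReal.ofReal t + T) = Real.exp (-α * t) * discount α T := by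
  by_cases hT : T = ∞
  · simp [discount, hT]
  · simp only [discount, ENNReal.add_eq_top, ENNReal.ofReal_ne_top, hT, or_self, if_false]
    rw [ENNReal.toReal_add ENNReal.ofReal_ne_top hT, ENNReal.toReal_ofReal ht, ← Real.exp_add]
    ring_nf

/-! ### Discounted ruin before a given gain -/

/-- The path from the second gain on; the left summand of the index type carries the interarrival
times and the right one the additive gains. -/
def shift (p : ℕ ⊕ ℕ → ℝ) : ℕ ⊕ ℕ → ℝ := fun i => p (Sum.map Nat.succ Nat.succ i)

/-- The discount factor of the time to ruin if ruin happens before the gain number `n` (counted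
from one), and `0` otherwise. -/
def ruinBefore (a α : ℝ) : ℕ → ℝ → (ℕ ⊕ ℕ → ℝ) → ℝ
  | 0, _, _ => 0
  | n + 1, x, p => if x < p (.inl 0) then Real.exp (-α * x) else
      Real.exp (-α * p (.inl 0))
        * ruinBefore a α n ((1 + a) * (x - p (.inl 0)) + p (.inr 0)) (shift p)

/-- The paths with positive interarrival times and gains that do not explode. -/
structure Regular (p : ℕ ⊕ ℕ → ℝ) : Prop where
  pos : ∀ i, 0 < p i
  unbounded : ∀ t, ∃ n, t < arrival (fun i => p (.inl i)) n

theorem Regular.shift {p : ℕ ⊕ ℕ → ℝ} (hp : Regular p) : Regular (shift p) where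
  pos i := hp.pos _
  unbounded t := by
    obtain ⟨n, hn⟩ := hp.unbounded (t + p (.inl 0))
    rcases n with _ | n
    · rw [arrival_zero] at hn
      exact ⟨0, by rw [arrival_zero]; linarith [hp.pos (.inl 0)]⟩
    · refine ⟨n, ?_⟩
      rw [arrival_succ] at hn
      have : arrival (fun i => DualRisk.shift p (.inl i)) n
          = arrival (fun i => p (.inl (i + 1))) n := rfl
      linarith

theorem next_surplus_pos {a x : ℝ} (ha : 0 < a) {p : ℕ ⊕ ℕ → ℝ} (hp : ∀ i, 0 < p i)
    (hx : p (.inl 0) ≤ x) : 0 < (1 + a) * (x - p (.inl 0)) + p (.inr 0) := by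
  have := hp (.inr 0)
  have : 0 ≤ (1 + a) * (x - p (.inl 0)) := mul_nonneg (by linarith) (by linarith)
  linarith

/-- Ties the measurable recursion to the infimum that defines ruin. After a first gain, the ruin
time and the arrival epoch both contain the summand `g 0`, which cancels from their comparison. -/
theorem ruinBefore_eq {a : ℝ} (ha : 0 < a) (α : ℝ) (n : ℕ) {x : ℝ} (hx : 0 < x)
    {p : ℕ ⊕ ℕ → ℝ} (hp : Regular p) :
    ruinBefore a α n x p =
      if ruinTime a x (fun i => p (.inl i)) (fun i => p (.inr i))
        < ENNReal.ofReal (arrival (fun i => p (.inl i)) n)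
      then discount α (ruinTime a x (fun i => p (.inl i)) (fun i => p (.inr i))) else 0 := by
  induction n generalizing x p with
  | zero => simp [ruinBefore, arrival_zero]
  | succ n ih =>
    have hg : ∀ i, 0 < p (.inl i) := fun i => hp.pos _
    rw [ruinBefore]
    split_ifs with h1 h2 h2
    · rw [ruinTime_of_lt a _ hg hx h1, discount_ofReal α hx.le]
    · refine absurd ?_ h2
      rw [ruinTime_of_lt a _ hg hx h1, ENNReal.ofReal_lt_ofReal_iff_of_nonneg hx.le, arrival_succ]
      linarith [arrival_nonneg (fun i => hg (i + 1)) n]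
    all_goals
      push Not at h1
      rw [ruinTime_of_le a _ hg hp.unbounded h1, arrival_succ, ENNReal.ofReal_add (hg 0).le
        (arrival_nonneg (fun i => hg (i + 1)) n),
        ENNReal.add_lt_add_iff_left ENNReal.ofReal_ne_top] at h2
      rw [ih (next_surplus_pos ha hp.pos h1) hp.shift]
    · rw [ruinTime_of_le a _ hg hp.unbounded h1, discount_ofReal_add α (hg 0).le, if_pos]
      · rfl
      · exact h2
    · rw [if_neg, mul_zero]
      exact h2

theorem tendsto_ruinBefore {a : ℝ} (ha : 0 < a) (α : ℝ) {x : ℝ} (hx : 0 < x)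
    {p : ℕ ⊕ ℕ → ℝ} (hp : Regular p) :
    Tendsto (fun n => ruinBefore a α n x p) atTop
      (𝓝 (discount α (ruinTime a x (fun i => p (.inl i)) (fun i => p (.inr i))))) := by
  simp only [ruinBefore_eq ha α _ hx hp]
  set T := ruinTime a x (fun i => p (.inl i)) (fun i => p (.inr i))
  by_cases hT : T = ∞
  · simp [hT, discount]
  · obtain ⟨N, hN⟩ := hp.unbounded T.toReal
    refine tendsto_const_nhds.congr' ?_
    filter_upwards [eventually_ge_atTop N] with n hn
    rw [if_pos]
    rw [ENNReal.lt_ofReal_iff_toReal_lt hT]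
    exact hN.trans_le ((strictMono_arrival (fun i => hp.pos _)).monotone hn)

theorem ruinBefore_nonneg (a α : ℝ) (n : ℕ) (x : ℝ) (p : ℕ ⊕ ℕ → ℝ) :
    0 ≤ ruinBefore a α n x p := by
  induction n generalizing x p with
  | zero => exact le_rfl
  | succ n ih =>
    rw [ruinBefore]
    split_ifs
    · positivity
    · exact mul_nonneg (by positivity) (ih _ _)

/-- The interarrival times, discounted by the growth of the surplus. -/
def discountedArrival (a : ℝ) (g : ℕ → ℝ) (n : ℕ) : ℝ := ∑ i ∈ Finset.range n, g i / (1 + a) ^ i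

theorem discountedArrival_succ {a : ℝ} (g : ℕ → ℝ) (n : ℕ) :
    discountedArrival a g (n + 1) =
      g 0 + discountedArrival a (fun i => g (i + 1)) n / (1 + a) := by
  rw [discountedArrival, Finset.sum_range_succ', discountedArrival, add_comm, Finset.sum_div]
  simp [pow_succ, div_div]

theorem ruinBefore_le_one {a α : ℝ} (ha : 0 < a) (hα : 0 ≤ α) (n : ℕ) {x : ℝ} (hx : 0 < x)
    {p : ℕ ⊕ ℕ → ℝ} (hp : ∀ i, 0 < p i) : ruinBefore a α n x p ≤ 1 := by
  induction n generalizing x p with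
  | zero => exact zero_le_one
  | succ n ih =>
    rw [ruinBefore]
    split_ifs with h1
    · exact Real.exp_le_one_iff.2 (by nlinarith)
    · push Not at h1
      refine mul_le_one₀ (Real.exp_le_one_iff.2 (by nlinarith [hp (.inl 0)]))
        (ruinBefore_nonneg ..) (ih (next_surplus_pos ha hp h1) fun i => hp _)

/-- Each gain multiplies the surplus by at least `1 + a`. In units deflated by these factors the
expenses are `g i / (1 + a) ^ i`, and a surplus above their total is never exhausted. -/
theorem ruinBefore_eq_zero {a α : ℝ} (ha : 0 < a) (n : ℕ) {x : ℝ}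
    {p : ℕ ⊕ ℕ → ℝ} (hp : ∀ i, 0 < p i)
    (h : discountedArrival a (fun i => p (.inl i)) n < x) : ruinBefore a α n x p = 0 := by
  induction n generalizing x p with
  | zero => rfl
  | succ n ih =>
    rw [discountedArrival_succ] at h
    have ha' : 0 < 1 + a := by linarith
    have h0 : 0 ≤ discountedArrival a (fun i => p (.inl (i + 1))) n / (1 + a) :=
      div_nonneg (Finset.sum_nonneg fun i _ => div_nonneg (hp _).le (by positivity)) ha'.le
    have hx : ¬ x < p (.inl 0) := by linarith
    rw [ruinBefore, if_neg hx, ih (p := shift p) (fun i => hp _), mul_zero]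
    have h2 : discountedArrival a (fun i => p (.inl (i + 1))) n < (x - p (.inl 0)) * (1 + a) := by
      rw [← div_lt_iff₀ ha']
      linarith
    change discountedArrival a (fun i => p (.inl (i + 1))) n < _
    linarith [hp (.inr 0)]

/-- Ruin before gain number `n` from the surplus `x` needs discounted interarrival times that sum
up to `x`. -/
theorem ruinBefore_le {a α : ℝ} (ha : 0 < a) (hα : 0 ≤ α) (n : ℕ) {x : ℝ} (hx : 0 < x)
    {p : ℕ ⊕ ℕ → ℝ} (hp : ∀ i, 0 < p i) {t : ℝ} (ht : 0 < t) :
    ruinBefore a α n x p ≤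
      1 - Real.exp (-t * discountedArrival a (fun i => p (.inl i)) n) + Real.exp (-t * x) := by
  rcases lt_or_ge (discountedArrival a (fun i => p (.inl i)) n) x with h | h
  · rw [ruinBefore_eq_zero ha n hp h]
    have h1 : Real.exp (-t * discountedArrival a (fun i => p (.inl i)) n) ≤ 1 := by
      refine Real.exp_le_one_iff.2 ?_
      have : 0 ≤ discountedArrival a (fun i => p (.inl i)) n :=
        Finset.sum_nonneg fun i _ => div_nonneg (hp _).le (by positivity)
      nlinarith
    linarith [Real.exp_pos (-t * x)]
  -- Here the right-hand side is at least `1`. This Markov-type bound is used because its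
  -- expectation is a product of transforms.
  · have h1 : Real.exp (-t * discountedArrival a (fun i => p (.inl i)) n) ≤ Real.exp (-t * x) :=
      Real.exp_le_exp.2 (by nlinarith)
    linarith [ruinBefore_le_one ha hα n hx hp]

/-! ### The law of the path -/

/-- The Laplace-Stieltjes transform at a real argument. -/
def realLst (F : Measure ℝ) (σ : ℝ) : ℝ := ∫ t, Real.exp (-σ * t) ∂F

/-- The marginals of the path of the model. -/
def marginal (F G : Measure ℝ) : ℕ ⊕ ℕ → Measure ℝ := Sum.elim (fun _ => F) (fun _ => G)

instance (F G : Measure ℝ) [IsProbabilityMeasure F] [IsProbabilityMeasure G] (i : ℕ ⊕ ℕ) :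
    IsProbabilityMeasure (marginal F G i) := by
  rcases i with i | i
  · exact inferInstanceAs (IsProbabilityMeasure F)
  · exact inferInstanceAs (IsProbabilityMeasure G)

/-- The joint law of independent interarrival times with law `F` and gains with law `G`. -/
def pathLaw (F G : Measure ℝ) [IsProbabilityMeasure F] [IsProbabilityMeasure G] :
    Measure (ℕ ⊕ ℕ → ℝ) := Measure.infinitePi (marginal F G)

theorem realLst_nonneg (F : Measure ℝ) (σ : ℝ) : 0 ≤ realLst F σ :=
  integral_nonneg fun _ => (Real.exp_pos _).le

theorem ae_prod_pos {F G : Measure ℝ} (hF : ∀ᵐ t ∂F, 0 < t) (hG : ∀ᵐ c ∂G, 0 < c) :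
    ∀ᵐ q ∂(F.prod G), 0 < q.1 ∧ 0 < q.2 := by
  filter_upwards [Measure.quasiMeasurePreserving_fst.ae hF,
    Measure.quasiMeasurePreserving_snd.ae hG] with q h1 h2 using ⟨h1, h2⟩

section pathLaw

variable {F G : Measure ℝ} [IsProbabilityMeasure F] [IsProbabilityMeasure G]

instance : IsProbabilityMeasure (pathLaw F G) := by unfold pathLaw; infer_instance

theorem map_eval_pathLaw (i : ℕ ⊕ ℕ) : (pathLaw F G).map (fun p => p i) = marginal F G i :=
  Measure.infinitePi_map_eval _ i

theorem iIndepFun_eval_pathLaw : iIndepFun (fun (i : ℕ ⊕ ℕ) (p : ℕ ⊕ ℕ → ℝ) => p i)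
    (pathLaw F G) :=
  iIndepFun_infinitePi (P := marginal F G) (X := fun _ x => x) fun _ => measurable_id

theorem ae_pathLaw_pos (hF : ∀ᵐ t ∂F, 0 < t) (hG : ∀ᵐ c ∂G, 0 < c) :
    ∀ᵐ p ∂(pathLaw F G), ∀ i, 0 < p i := by
  rw [ae_all_iff]
  intro i
  have h : ∀ᵐ t ∂((pathLaw F G).map (fun p => p i)), 0 < t := by
    rw [map_eval_pathLaw]
    rcases i with i | i
    · exact hF
    · exact hG
  exact ae_of_ae_map (measurable_pi_apply i).aemeasurable h

/-- By independence. Constant weights serve for non-explosion, geometric weights for the discounted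
arrivals. -/
theorem integral_exp_sum_pathLaw (w : ℕ → ℝ) (n : ℕ) :
    ∫ p, Real.exp (-∑ i ∈ Finset.range n, w i * p (.inl i)) ∂(pathLaw F G)
      = ∏ i ∈ Finset.range n, realLst F (w i) := by
  have hind : iIndepFun (fun (i : ℕ) (p : ℕ ⊕ ℕ → ℝ) => -w i * p (.inl i)) (pathLaw F G) :=
    (iIndepFun_eval_pathLaw.precomp Sum.inl_injective).comp (fun i x => -w i * x)
      (fun i => by fun_prop)
  have h := hind.mgf_sum (t := 1) (fun i => by fun_prop) (Finset.range n)
  simp only [mgf, one_mul, Finset.sum_apply] at h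
  simp only [← Finset.sum_neg_distrib, ← neg_mul]
  rw [h]
  refine Finset.prod_congr rfl fun i _ => ?_
  have h2 : (pathLaw F G).map (fun p => p (.inl i)) = F := map_eval_pathLaw (.inl i)
  rw [realLst]
  conv_rhs => rw [← h2]
  rw [integral_map (measurable_pi_apply _).aemeasurable (by fun_prop)]

theorem realLst_lt_one (hF : ∀ᵐ t ∂F, 0 < t) {σ : ℝ} (hσ : 0 < σ) : realLst F σ < 1 := by
  have h1 : ∀ᵐ t ∂F, 0 < 1 - Real.exp (-σ * t) := by
    filter_upwards [hF] with t ht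
    have : Real.exp (-σ * t) < 1 := Real.exp_lt_one_iff.2 (by nlinarith)
    linarith
  have hi : Integrable (fun t => Real.exp (-σ * t)) F := by
    refine Integrable.of_bound (by fun_prop) 1 ?_
    filter_upwards [h1] with t ht
    rw [Real.norm_eq_abs, Real.abs_exp]
    linarith
  have h2 : 0 < ∫ t, (1 - Real.exp (-σ * t)) ∂F := by
    rw [integral_pos_iff_support_of_nonneg_ae (h1.mono fun t ht => ht.le)
      ((integrable_const 1).sub hi)]
    have : (Function.support fun t => 1 - Real.exp (-σ * t)) =ᵐ[F] (Set.univ : Set ℝ) := by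
      filter_upwards [h1] with t ht
      exact propext ⟨fun _ => trivial, fun _ => ht.ne'⟩
    rw [measure_congr this]
    simp
  rw [integral_sub (integrable_const 1) hi] at h2
  simp only [integral_const, probReal_univ, smul_eq_mul, one_mul] at h2
  rw [realLst]
  linarith

/-- A Chernoff bound: if all arrivals stay below `m`, then `exp (-m)` times the probability of this
is at most `E[exp (-T_n)] = φ(1) ^ n`, which tends to `0`. -/
theorem ae_pathLaw_unbounded (hF : ∀ᵐ t ∂F, 0 < t) :
    ∀ᵐ p ∂(pathLaw F G), ∀ t, ∃ n, t < arrival (fun i => p (.inl i)) n := by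
  have key : ∀ m : ℕ, ∀ᵐ p ∂(pathLaw F G), ∃ n, (m : ℝ) < arrival (fun i => p (.inl i)) n := by
    intro m
    have hbound : ∀ n : ℕ, Real.exp (-m) * (pathLaw F G).real
        {p | ¬ ∃ n, (m : ℝ) < arrival (fun i => p (.inl i)) n} ≤ realLst F 1 ^ n := by
      intro n
      have h1 := integral_exp_sum_pathLaw (F := F) (G := G) (fun _ => 1) n
      simp only [one_mul, Finset.prod_const, Finset.card_range] at h1
      by_cases hi : Integrable (fun p : ℕ ⊕ ℕ → ℝ =>
          Real.exp (-∑ i ∈ Finset.range n, p (.inl i))) (pathLaw F G)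
      · rw [← h1]
        refine le_trans ?_ (mul_meas_ge_le_integral_of_nonneg
          (Eventually.of_forall fun p => (Real.exp_pos _).le) hi (Real.exp (-m)))
        refine mul_le_mul_of_nonneg_left (measureReal_mono fun p hp => ?_) (Real.exp_pos _).le
        exact Real.exp_le_exp.2 (neg_le_neg (not_lt.1 (not_exists.1 hp n)))
      -- A nonzero Bochner integral forces integrability, and this one is a power of `φ(1) > 0`.
      · exfalso
        apply hi
        refine Integrable.of_integral_ne_zero ?_
        rw [h1]
        have : 0 < realLst F 1 := by
          refine integral_exp_pos ?_
          refine Integrable.of_bound (by fun_prop) 1 ?_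
          filter_upwards [hF] with t ht
          rw [Real.norm_eq_abs, Real.abs_exp]
          exact Real.exp_le_one_iff.2 (by linarith)
        positivity
    have hlim : Tendsto (fun n : ℕ => realLst F 1 ^ n) atTop (𝓝 0) :=
      tendsto_pow_atTop_nhds_zero_of_lt_one (realLst_nonneg F 1) (realLst_lt_one hF one_pos)
    have h0 := ge_of_tendsto' hlim hbound
    have h3 : (pathLaw F G).real {p | ¬ ∃ n, (m : ℝ) < arrival (fun i => p (.inl i)) n} = 0 := by
      have := Real.exp_pos (-(m : ℝ))
      exact le_antisymm (nonpos_of_mul_nonpos_right h0 this) measureReal_nonneg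
    rw [ae_iff]
    rwa [measureReal_eq_zero_iff] at h3
  filter_upwards [ae_all_iff.2 key] with p hp t
  obtain ⟨m, hm⟩ := exists_nat_ge t
  obtain ⟨n, hn⟩ := hp m
  exact ⟨n, hm.trans_lt hn⟩

theorem ae_pathLaw_regular (hF : ∀ᵐ t ∂F, 0 < t) (hG : ∀ᵐ c ∂G, 0 < c) :
    ∀ᵐ p ∂(pathLaw F G), Regular p := by
  filter_upwards [ae_pathLaw_pos hF hG, ae_pathLaw_unbounded hF] with p h1 h2 using ⟨h1, h2⟩

theorem measurable_shift : Measurable shift :=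
  measurable_pi_lambda _ fun _ => measurable_pi_apply _

theorem map_shift_pathLaw : (pathLaw F G).map shift = pathLaw F G := by
  have hinj : Function.Injective (Sum.map Nat.succ Nat.succ) :=
    Sum.map_injective.2 ⟨Nat.succ_injective, Nat.succ_injective⟩
  have h := Measure.map_infinitePi_infinitePi_of_inj (P := marginal F G) hinj
  have h2 : (fun i : ℕ ⊕ ℕ => marginal F G (Sum.map Nat.succ Nat.succ i)) = marginal F G := by
    funext i
    rcases i with i | i <;> rfl
  simp only [h2] at h
  exact h

/-- The two maps depend on disjoint sets of coordinates. -/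
theorem indepFun_first_shift :
    IndepFun (fun p : ℕ ⊕ ℕ → ℝ => (p (.inl 0), p (.inr 0))) shift (pathLaw F G) := by
  have hi := (iIndepFun_eval_pathLaw (F := F) (G := G)).iIndep
  have hd : Disjoint ({.inl 0, .inr 0} : Set (ℕ ⊕ ℕ))
      (Set.range (Sum.map Nat.succ Nat.succ)) := by
    rw [Set.disjoint_left]
    rintro i (rfl | rfl) ⟨j, hj⟩ <;> rcases j with j | j <;> simp at hj
  have h := indep_iSup_of_disjoint (fun i => (measurable_pi_apply i).comap_le) hi hd
  rw [IndepFun_iff_Indep]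
  have hm : ∀ (S : Set (ℕ ⊕ ℕ)) (i : ℕ ⊕ ℕ), i ∈ S →
      Measurable[⨆ j ∈ S, MeasurableSpace.comap (fun p : ℕ ⊕ ℕ → ℝ => p j) inferInstance]
        (fun p : ℕ ⊕ ℕ → ℝ => p i) := by
    intro S i hi
    exact (comap_measurable _).mono
      (le_iSup₂ (f := fun j (_ : j ∈ S) =>
        MeasurableSpace.comap (fun p : ℕ ⊕ ℕ → ℝ => p j) inferInstance) i hi) le_rfl
  refine indep_of_indep_of_le_left (indep_of_indep_of_le_right h ?_) ?_
  · rw [← measurable_iff_comap_le]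
    exact @measurable_pi_lambda _ _ _ (_) _ _ fun i => hm _ _ ⟨i, rfl⟩
  · rw [← measurable_iff_comap_le]
    exact @Measurable.prodMk _ _ _ _ _ (_) _ _ (hm _ _ (by simp)) (hm _ _ (by simp))

theorem map_first_shift_pathLaw :
    (pathLaw F G).map (fun p => ((p (.inl 0), p (.inr 0)), shift p))
      = (F.prod G).prod (pathLaw F G) := by
  rw [(indepFun_iff_map_prod_eq_prod_map_map (by fun_prop) measurable_shift.aemeasurable).1
    indepFun_first_shift, map_shift_pathLaw]
  congr 1
  exact Measure.infinitePi_map_eval_prod (P := marginal F G) (by simp)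

/-! ### The discount factor of the time to ruin -/

theorem measurable_ruinBefore (a α : ℝ) (n : ℕ) :
    Measurable fun q : ℝ × (ℕ ⊕ ℕ → ℝ) => ruinBefore a α n q.1 q.2 := by
  induction n with
  | zero => exact measurable_const
  | succ n ih =>
    simp only [ruinBefore]
    refine Measurable.ite (measurableSet_lt (by fun_prop) (by fun_prop)) (by fun_prop) ?_
    refine Measurable.mul (by fun_prop) (ih.comp (Measurable.prodMk (by fun_prop) ?_))
    exact measurable_shift.comp measurable_snd

/-- The expected discount factor of the time to ruin from the surplus `x > 0`, continued by `0`. -/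
def ruinTransform (F G : Measure ℝ) [IsProbabilityMeasure F] [IsProbabilityMeasure G]
    (a α x : ℝ) : ℝ :=
  if 0 < x then ∫ p, discount α (ruinTime a x (fun i => p (.inl i)) (fun i => p (.inr i)))
    ∂(pathLaw F G) else 0

variable {a α : ℝ}

/-- The time to ruin is an infimum over uncountably many times; measurability is inherited from the
truncations, which converge on regular paths. -/
theorem aestronglyMeasurable_discount_ruinTime (hF : ∀ᵐ t ∂F, 0 < t) (hG : ∀ᵐ c ∂G, 0 < c)
    (ha : 0 < a) {x : ℝ} (hx : 0 < x) :
    AEStronglyMeasurable (fun p : ℕ ⊕ ℕ → ℝ =>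
      discount α (ruinTime a x (fun i => p (.inl i)) (fun i => p (.inr i)))) (pathLaw F G) := by
  refine aestronglyMeasurable_of_tendsto_ae atTop (f := fun n p => ruinBefore a α n x p)
    (fun n => ((measurable_ruinBefore a α n).comp measurable_prodMk_left).aestronglyMeasurable) ?_
  filter_upwards [ae_pathLaw_regular hF hG] with p hp using tendsto_ruinBefore ha α hx hp

theorem tendsto_integral_ruinBefore (hF : ∀ᵐ t ∂F, 0 < t) (hG : ∀ᵐ c ∂G, 0 < c)
    (ha : 0 < a) (hα : 0 ≤ α) {x : ℝ} (hx : 0 < x) :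
    Tendsto (fun n => ∫ p, ruinBefore a α n x p ∂(pathLaw F G)) atTop
      (𝓝 (ruinTransform F G a α x)) := by
  rw [ruinTransform, if_pos hx]
  refine tendsto_integral_of_dominated_convergence (fun _ => 1)
    (fun n => ((measurable_ruinBefore a α n).comp measurable_prodMk_left).aestronglyMeasurable)
    (integrable_const 1) (fun n => ?_) ?_
  · filter_upwards [ae_pathLaw_pos hF hG] with p hp
    rw [Real.norm_of_nonneg (ruinBefore_nonneg ..)]
    exact ruinBefore_le_one ha hα n hx hp
  · filter_upwards [ae_pathLaw_regular hF hG] with p hp using tendsto_ruinBefore ha α hx hp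

theorem measurable_integral_ruinBefore (n : ℕ) :
    Measurable fun x => ∫ p, ruinBefore a α n x p ∂(pathLaw F G) :=
  (measurable_ruinBefore a α n).stronglyMeasurable.integral_prod_right.measurable

theorem measurable_ruinTransform (hF : ∀ᵐ t ∂F, 0 < t) (hG : ∀ᵐ c ∂G, 0 < c)
    (ha : 0 < a) (hα : 0 ≤ α) : Measurable (ruinTransform F G a α) := by
  refine measurable_of_tendsto_metrizable (f := fun n => (Set.Ioi 0).indicator
    fun x => ∫ p, ruinBefore a α n x p ∂(pathLaw F G))
    (fun n => (measurable_integral_ruinBefore n).indicator measurableSet_Ioi) ?_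
  rw [tendsto_pi_nhds]
  intro x
  by_cases hx : 0 < x
  · simpa [Set.indicator, hx] using tendsto_integral_ruinBefore hF hG ha hα hx
  · simp [Set.indicator, hx, ruinTransform]

theorem integral_ruinBefore_nonneg (n : ℕ) (x : ℝ) :
    0 ≤ ∫ p, ruinBefore a α n x p ∂(pathLaw F G) :=
  integral_nonneg fun _ => ruinBefore_nonneg ..

theorem integrable_ruinBefore (hF : ∀ᵐ t ∂F, 0 < t) (hG : ∀ᵐ c ∂G, 0 < c)
    (ha : 0 < a) (hα : 0 ≤ α) (n : ℕ) {x : ℝ} (hx : 0 < x) :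
    Integrable (ruinBefore a α n x) (pathLaw F G) := by
  refine Integrable.of_bound
    ((measurable_ruinBefore a α n).comp measurable_prodMk_left).aestronglyMeasurable 1 ?_
  filter_upwards [ae_pathLaw_pos hF hG] with p hp
  rw [Real.norm_of_nonneg (ruinBefore_nonneg ..)]
  exact ruinBefore_le_one ha hα n hx hp

theorem integral_ruinBefore_le_one (hF : ∀ᵐ t ∂F, 0 < t) (hG : ∀ᵐ c ∂G, 0 < c)
    (ha : 0 < a) (hα : 0 ≤ α) (n : ℕ) {x : ℝ} (hx : 0 < x) :
    ∫ p, ruinBefore a α n x p ∂(pathLaw F G) ≤ 1 := by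
  have : ∫ p, ruinBefore a α n x p ∂(pathLaw F G) ≤ ∫ _, (1 : ℝ) ∂(pathLaw F G) := by
    refine integral_mono_ae (integrable_ruinBefore hF hG ha hα n hx) (integrable_const 1) ?_
    filter_upwards [ae_pathLaw_pos hF hG] with p hp using ruinBefore_le_one ha hα n hx hp
  simpa using this

theorem ruinTransform_nonneg (x : ℝ) : 0 ≤ ruinTransform F G a α x := by
  rw [ruinTransform]
  split_ifs
  · refine integral_nonneg fun p => ?_
    simp only [discount]
    split_ifs <;> positivity
  · exact le_rfl

theorem ruinTransform_le_one (hF : ∀ᵐ t ∂F, 0 < t) (hG : ∀ᵐ c ∂G, 0 < c)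
    (ha : 0 < a) (hα : 0 ≤ α) (x : ℝ) : ruinTransform F G a α x ≤ 1 := by
  by_cases hx : 0 < x
  · exact le_of_tendsto' (tendsto_integral_ruinBefore hF hG ha hα hx)
      fun n => integral_ruinBefore_le_one hF hG ha hα n hx
  · simp [ruinTransform, hx]

theorem integral_ruinBefore_succ (hF : ∀ᵐ t ∂F, 0 < t) (hG : ∀ᵐ c ∂G, 0 < c)
    (ha : 0 < a) (hα : 0 ≤ α) (n : ℕ) {x : ℝ} (hx : 0 < x) :
    ∫ p, ruinBefore a α (n + 1) x p ∂(pathLaw F G) =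
      ∫ q, (if x < q.1 then Real.exp (-α * x) else Real.exp (-α * q.1)
        * ∫ p, ruinBefore a α n ((1 + a) * (x - q.1) + q.2) p ∂(pathLaw F G)) ∂(F.prod G) := by
  set h : (ℝ × ℝ) × (ℕ ⊕ ℕ → ℝ) → ℝ := fun q =>
    if x < q.1.1 then Real.exp (-α * x) else Real.exp (-α * q.1.1)
        * ruinBefore a α n ((1 + a) * (x - q.1.1) + q.1.2) q.2 with hdef
  have hm : Measurable h :=
    Measurable.ite (measurableSet_lt (by fun_prop) (by fun_prop)) (by fun_prop)
      (Measurable.mul (by fun_prop) ((measurable_ruinBefore a α n).comp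
        (f := fun q : (ℝ × ℝ) × (ℕ ⊕ ℕ → ℝ) => ((1 + a) * (x - q.1.1) + q.1.2, q.2))
        (by fun_prop)))
  have hΦ : Measurable fun p : ℕ ⊕ ℕ → ℝ => ((p (.inl 0), p (.inr 0)), shift p) :=
    Measurable.prodMk (by fun_prop) measurable_shift
  have h1 : ∫ p, ruinBefore a α (n + 1) x p ∂(pathLaw F G)
      = ∫ q, h q ∂((F.prod G).prod (pathLaw F G)) := by
    rw [← map_first_shift_pathLaw, integral_map hΦ.aemeasurable hm.aestronglyMeasurable]
    rfl
  have hint : Integrable h ((F.prod G).prod (pathLaw F G)) := by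
    rw [← map_first_shift_pathLaw, integrable_map_measure hm.aestronglyMeasurable hΦ.aemeasurable]
    exact integrable_ruinBefore hF hG ha hα (n + 1) hx
  rw [h1, integral_prod _ hint]
  refine integral_congr_ae (Eventually.of_forall fun q => ?_)
  simp only [hdef]
  split_ifs
  · simp
  · rw [integral_const_mul]

/-- The limit, by dominated convergence, of the same equation for the jointly measurable
truncations. Convergence is known only from positive surpluses, and the next surplus is almost
surely positive. -/
theorem ruinTransform_renewal (hF : ∀ᵐ t ∂F, 0 < t) (hG : ∀ᵐ c ∂G, 0 < c)
    (ha : 0 < a) (hα : 0 ≤ α) {x : ℝ} (hx : 0 < x) :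
    ruinTransform F G a α x = ∫ q, (if x < q.1 then Real.exp (-α * x) else Real.exp (-α * q.1)
        * ruinTransform F G a α ((1 + a) * (x - q.1) + q.2)) ∂(F.prod G) := by
  refine tendsto_nhds_unique
    ((tendsto_integral_ruinBefore hF hG ha hα hx).comp (tendsto_add_atTop_nat 1)) ?_
  simp only [Function.comp_def, integral_ruinBefore_succ hF hG ha hα _ hx]
  have hnext : ∀ q : ℝ × ℝ, 0 < q.1 ∧ 0 < q.2 → ¬ x < q.1 →
      0 < (1 + a) * (x - q.1) + q.2 := by
    intro q hq hxq
    have : 0 ≤ (1 + a) * (x - q.1) := mul_nonneg (by linarith) (by linarith)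
    linarith [hq.2]
  refine tendsto_integral_of_dominated_convergence (fun _ => 1) (fun n => ?_)
    (integrable_const 1) (fun n => ?_) ?_
  · refine (Measurable.ite (measurableSet_lt (by fun_prop) (by fun_prop)) (by fun_prop)
      (Measurable.mul (by fun_prop) ?_)).aestronglyMeasurable
    exact (measurable_integral_ruinBefore n).comp (by fun_prop)
  · filter_upwards [ae_prod_pos hF hG] with q hq
    split_ifs with h
    · rw [Real.norm_of_nonneg (Real.exp_pos _).le]
      exact Real.exp_le_one_iff.2 (by nlinarith)
    · rw [Real.norm_of_nonneg
        (mul_nonneg (Real.exp_pos _).le (integral_ruinBefore_nonneg _ _))]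
      exact mul_le_one₀ (Real.exp_le_one_iff.2 (by nlinarith [hq.1]))
        (integral_ruinBefore_nonneg _ _)
        (integral_ruinBefore_le_one hF hG ha hα n (hnext q hq h))
  · filter_upwards [ae_prod_pos hF hG] with q hq
    split_ifs with h
    · exact tendsto_const_nhds
    · exact (tendsto_integral_ruinBefore hF hG ha hα (hnext q hq h)).const_mul _

/-- A bound that makes ruin unlikely from a large surplus, when the discounted interarrival times
have a finite sum. -/
theorem ruinTransform_le (hF : ∀ᵐ t ∂F, 0 < t) (hG : ∀ᵐ c ∂G, 0 < c)
    (ha : 0 < a) (hα : 0 ≤ α) {t : ℝ} (ht : 0 < t) {L : ℝ}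
    (hL : ∀ n, L ≤ ∏ i ∈ Finset.range n, realLst F (t / (1 + a) ^ i)) {x : ℝ} (hx : 0 < x) :
    ruinTransform F G a α x ≤ 1 - L + Real.exp (-t * x) := by
  refine le_of_tendsto' (tendsto_integral_ruinBefore hF hG ha hα hx) fun n => ?_
  have h1 := integral_exp_sum_pathLaw (F := F) (G := G) (fun i => t / (1 + a) ^ i) n
  have h2 : ∀ p : ℕ ⊕ ℕ → ℝ, -t * discountedArrival a (fun i => p (.inl i)) n
      = -∑ i ∈ Finset.range n, t / (1 + a) ^ i * p (.inl i) := by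
    intro p
    rw [discountedArrival, neg_mul, Finset.mul_sum]
    congr 1
    refine Finset.sum_congr rfl fun i _ => by ring
  have hi : Integrable (fun p : ℕ ⊕ ℕ → ℝ =>
      Real.exp (-t * discountedArrival a (fun i => p (.inl i)) n)) (pathLaw F G) := by
    refine Integrable.of_bound (Measurable.aestronglyMeasurable ?_) 1 ?_
    · simp only [discountedArrival]
      fun_prop
    · filter_upwards [ae_pathLaw_pos hF hG] with p hp
      rw [Real.norm_of_nonneg (Real.exp_pos _).le]
      refine Real.exp_le_one_iff.2 ?_
      have : 0 ≤ discountedArrival a (fun i => p (.inl i)) n :=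
        Finset.sum_nonneg fun i _ => div_nonneg (hp _).le (by positivity)
      nlinarith
  have h3 : ∫ p, Real.exp (-t * discountedArrival a (fun i => p (.inl i)) n) ∂(pathLaw F G)
      = ∏ i ∈ Finset.range n, realLst F (t / (1 + a) ^ i) := by
    rw [← h1]
    exact integral_congr_ae (Eventually.of_forall fun p => congrArg Real.exp (h2 p))
  have h4 := integral_add (hi.const_mul (-1)) (integrable_const (1 + Real.exp (-t * x)))
  rw [integral_const_mul, h3, integral_const, probReal_univ, one_smul] at h4
  have h5 : ∫ p, ruinBefore a α n x p ∂(pathLaw F G) ≤ ∫ p,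
      (-1 * Real.exp (-t * discountedArrival a (fun i => p (.inl i)) n)
        + (1 + Real.exp (-t * x))) ∂(pathLaw F G) := by
    refine integral_mono_ae (integrable_ruinBefore hF hG ha hα n hx)
      ((hi.const_mul (-1)).add (integrable_const _)) ?_
    filter_upwards [ae_pathLaw_pos hF hG] with p hp
    linarith [ruinBefore_le ha hα n hx hp ht]
  linarith [hL n]

end pathLaw

/-! ### Laplace transforms of bounded functions -/

/-- The Laplace transform of a function on the positive half-line. -/
def laplace (f : ℝ → ℝ) (s : ℂ) : ℂ := ∫ x in Set.Ioi (0 : ℝ), Complex.exp (-s * x) * (f x : ℂ)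

theorem norm_exp_neg_mul_ofReal (s : ℂ) (x : ℝ) :
    ‖Complex.exp (-s * x)‖ = Real.exp (-s.re * x) := by
  rw [Complex.norm_exp]
  simp

theorem integrableOn_laplace {f : ℝ → ℝ} (hf : Measurable f) (h0 : ∀ x, 0 ≤ f x)
    (h1 : ∀ x, f x ≤ 1) {s : ℂ} (hs : 0 < s.re) :
    IntegrableOn (fun x : ℝ => Complex.exp (-s * x) * (f x : ℂ)) (Set.Ioi 0) := by
  refine Integrable.mono' (exp_neg_integrableOn_Ioi 0 hs)
    (Measurable.aestronglyMeasurable (by fun_prop)) (Eventually.of_forall fun x => ?_)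
  rw [norm_mul, norm_exp_neg_mul_ofReal, Complex.norm_real, Real.norm_of_nonneg (h0 x)]
  exact mul_le_of_le_one_right (Real.exp_pos _).le (h1 x)

theorem setIntegral_Ioi_comp_sub (g : ℝ → ℂ) (t : ℝ) :
    ∫ x in Set.Ioi t, g (x - t) = ∫ y in Set.Ioi (0 : ℝ), g y := by
  rw [← integral_indicator measurableSet_Ioi, ← integral_indicator measurableSet_Ioi,
    ← integral_sub_right_eq_self ((Set.Ioi (0 : ℝ)).indicator g) t]
  refine integral_congr_ae (Eventually.of_forall fun x => ?_)
  simp [Set.indicator]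

theorem setIntegral_Ioo_exp {z : ℂ} (hz : z ≠ 0) {t : ℝ} (ht : 0 ≤ t) :
    ∫ x in Set.Ioo (0 : ℝ) t, Complex.exp (z * x) = (Complex.exp (z * t) - 1) / z := by
  rw [← integral_Ioc_eq_integral_Ioo, ← intervalIntegral.integral_of_le ht,
    integral_exp_mul_complex hz]
  simp

/-- The Laplace transform of `x ↦ E[if x < T then exp (-α x) else exp (-α T) k (x - T)]`. -/
theorem laplace_renewal {F : Measure ℝ} [IsProbabilityMeasure F] (hF : ∀ᵐ t ∂F, 0 < t)
    {α : ℝ} (hα : 0 ≤ α) {k : ℝ → ℝ} (hk : Measurable k) (h0 : ∀ x, 0 ≤ k x)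
    (h1 : ∀ x, k x ≤ 1) {s : ℂ} (hs : 0 < s.re) :
    ∫ x in Set.Ioi (0 : ℝ), Complex.exp (-s * x) * ((∫ t, (if x < t then Real.exp (-α * x) else
        Real.exp (-α * t) * k (x - t)) ∂F : ℝ) : ℂ)
      = (1 - lst F (s + α)) / (s + α) + lst F (s + α) * laplace k s := by
  have hz : s + α ≠ 0 := by
    intro h
    have := congrArg Complex.re h
    simp at this
    linarith
  set w : ℝ → ℝ → ℝ := fun x t => if x < t then Real.exp (-α * x) else
    Real.exp (-α * t) * k (x - t) with hw
  have hwm : Measurable (Function.uncurry w) :=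
    Measurable.ite (measurableSet_lt (by fun_prop) (by fun_prop)) (by fun_prop) (by fun_prop)
  have hw0 : ∀ x t, 0 ≤ w x t := by
    intro x t
    simp only [hw]
    split_ifs
    · positivity
    · exact mul_nonneg (Real.exp_pos _).le (h0 _)
  have hw1 : ∀ x t, 0 < x → 0 < t → w x t ≤ 1 := by
    intro x t hx ht
    simp only [hw]
    split_ifs
    · exact Real.exp_le_one_iff.2 (by nlinarith)
    · exact mul_le_one₀ (Real.exp_le_one_iff.2 (by nlinarith)) (h0 _) (h1 _)
  have hint : Integrable (Function.uncurry fun x t : ℝ => Complex.exp (-s * x) * (w x t : ℂ))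
      ((volume.restrict (Set.Ioi (0 : ℝ))).prod F) := by
    refine Integrable.mono' ((exp_neg_integrableOn_Ioi 0 hs).comp_fst F)
      (Measurable.aestronglyMeasurable ?_) ?_
    · exact Measurable.mul (by fun_prop) (Complex.measurable_ofReal.comp hwm)
    · filter_upwards [Measure.quasiMeasurePreserving_fst.ae (ae_restrict_mem measurableSet_Ioi),
        Measure.quasiMeasurePreserving_snd.ae hF] with q hq1 hq2
      simp only [Function.uncurry]
      rw [norm_mul, norm_exp_neg_mul_ofReal, Complex.norm_real, Real.norm_of_nonneg (hw0 _ _)]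
      exact mul_le_of_le_one_right (Real.exp_pos _).le (hw1 _ _ hq1 hq2)
  have hswap := integral_integral_swap hint
  simp only [integral_const_mul, integral_complex_ofReal] at hswap
  rw [hswap]
  -- Splitting at `x = t` leaves an expression affine in `exp (-(s + α) t)`, so integrating over `t`
  -- only produces `φ(s + α)`.
  have hinner : ∀ᵐ t ∂F, ∫ x in Set.Ioi (0 : ℝ), Complex.exp (-s * x) * (w x t : ℂ)
      = 1 / (s + α) + Complex.exp (-(s + α) * t) * (laplace k s - 1 / (s + α)) := by
    have hsec := hint.prod_left_ae
    filter_upwards [hF, hsec] with t ht hit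
    have hunion : Set.Ioi (0 : ℝ) = Set.Ioo 0 t ∪ Set.Ici t := (Set.Ioo_union_Ici_eq_Ioi ht).symm
    have hi : IntegrableOn (fun x : ℝ => Complex.exp (-s * x) * (w x t : ℂ)) (Set.Ioi 0) := hit
    have hdisj : Disjoint (Set.Ioo 0 t) (Set.Ici t) :=
      Set.disjoint_left.2 fun x hx hx' => not_le.2 hx.2 hx'
    rw [hunion, setIntegral_union hdisj
      measurableSet_Ici (hi.mono_set (by rw [hunion]; exact Set.subset_union_left))
      (hi.mono_set (by rw [hunion]; exact Set.subset_union_right))]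
    have e1 : ∫ x in Set.Ioo (0 : ℝ) t, Complex.exp (-s * x) * (w x t : ℂ)
        = ∫ x in Set.Ioo (0 : ℝ) t, Complex.exp (-(s + α) * x) := by
      refine setIntegral_congr_fun measurableSet_Ioo fun x hx => ?_
      simp only [hw, if_pos hx.2]
      push_cast
      rw [← Complex.exp_add]
      ring_nf
    have e2 : ∫ x in Set.Ici t, Complex.exp (-s * x) * (w x t : ℂ)
        = ∫ x in Set.Ici t, (fun y : ℝ => Complex.exp (-(s + α) * t)
          * (Complex.exp (-s * y) * (k y : ℂ))) (x - t) := by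
      refine setIntegral_congr_fun measurableSet_Ici fun x hx => ?_
      simp only [hw, if_neg (not_lt.2 (Set.mem_Ici.1 hx))]
      push_cast
      rw [← mul_assoc, ← mul_assoc, ← Complex.exp_add, ← Complex.exp_add]
      ring_nf
    rw [e1, e2, setIntegral_Ioo_exp (neg_ne_zero.2 hz) ht.le, integral_Ici_eq_integral_Ioi,
      setIntegral_Ioi_comp_sub (fun y : ℝ => Complex.exp (-(s + α) * t)
        * (Complex.exp (-s * y) * (k y : ℂ))) t, integral_const_mul, ← laplace]
    field_simp
    ring
  have hexp : Integrable (fun t : ℝ => Complex.exp (-(s + α) * t)) F := by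
    refine Integrable.of_bound (Measurable.aestronglyMeasurable (by fun_prop)) 1 ?_
    filter_upwards [hF] with t ht
    rw [norm_exp_neg_mul_ofReal]
    refine Real.exp_le_one_iff.2 ?_
    simp only [Complex.add_re, Complex.ofReal_re]
    nlinarith
  rw [integral_congr_ae hinner, integral_add (integrable_const _) (hexp.mul_const _),
    integral_const, probReal_univ, one_smul, integral_mul_const, ← lst]
  field_simp
  ring

theorem integral_expMeasure {mu : ℝ} (hmu : 0 < mu) (h : ℝ → ℝ) :
    ∫ c, h c ∂(expMeasure mu) = ∫ c in Set.Ioi (0 : ℝ), mu * Real.exp (-mu * c) * h c := by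
  have h0 : ∀ c, (exponentialPDF mu c).toReal • h c
      = (Set.Ici (0 : ℝ)).indicator (fun c => mu * Real.exp (-mu * c) * h c) c := by
    intro c
    rw [exponentialPDF_eq]
    by_cases hc : 0 ≤ c
    · have h2 : 0 ≤ mu * Real.exp (-(mu * c)) := by positivity
      simp [hc, ENNReal.toReal_ofReal h2]
    · simp [hc]
  have h3 : expMeasure mu = volume.withDensity (exponentialPDF mu) := rfl
  have hm : Measurable (exponentialPDF mu) := (measurable_exponentialPDFReal mu).ennreal_ofReal
  rw [h3, integral_withDensity_eq_integral_toReal_smul hm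
    (Eventually.of_forall fun c => ENNReal.ofReal_lt_top)]
  simp only [h0]
  rw [integral_indicator measurableSet_Ici, integral_Ici_eq_integral_Ioi]

theorem ae_expMeasure_pos (mu : ℝ) : ∀ᵐ c ∂(expMeasure mu), 0 < c := by
  have h3 : expMeasure mu = volume.withDensity (exponentialPDF mu) := rfl
  have h4 : expMeasure mu (Set.Iio 0) = 0 := by
    rw [h3, withDensity_apply _ measurableSet_Iio]
    exact lintegral_exponentialPDF_of_nonpos le_rfl
  have h5 : expMeasure mu {0} = 0 :=
    withDensity_absolutelyContinuous volume (exponentialPDF mu) (by simp)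
  rw [ae_iff]
  refine measure_mono_null (fun c hc => ?_) (measure_union_null h4 h5)
  exact (not_lt.1 hc).lt_or_eq

/-- Substitute `z = (1 + a) y + c` and integrate over `y` first, with `d = μ (1 + a) - s`. The
integral of `exp (d y)` over `(0, z / (1 + a))` is `(exp (d z / (1 + a)) - 1) / d`; against `μ exp
(-μ z) f z` its two terms give the transforms at `s / (1 + a)` and at `μ`. -/
theorem laplace_exponential {a mu : ℝ} (ha : 0 < a) (hmu : 0 < mu) {f : ℝ → ℝ}
    (hf : Measurable f) (h0 : ∀ x, 0 ≤ f x) (h1 : ∀ x, f x ≤ 1) {s : ℂ} (hs : 0 < s.re)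
    (hne : s ≠ mu * (1 + a)) :
    laplace (fun y => ∫ c, f ((1 + a) * y + c) ∂(expMeasure mu)) s
      = mu / (mu * (1 + a) - s) * (laplace f (s / (1 + a)) - laplace f mu) := by
  have ha' : 0 < 1 + a := by linarith
  have hac : (1 + a : ℂ) ≠ 0 := by exact_mod_cast ha'.ne'
  set d : ℂ := mu * (1 + a) - s with hd
  have hd0 : d ≠ 0 := sub_ne_zero.2 hne.symm
  set v : ℝ → ℝ := fun z => mu * Real.exp (-mu * z) * f z with hv
  have hv0 : ∀ z, 0 ≤ v z := fun z => mul_nonneg (by positivity) (h0 z)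
  have hv1 : ∀ z, v z ≤ mu * Real.exp (-mu * z) := fun z =>
    mul_le_of_le_one_right (by positivity) (h1 z)
  have hvm : Measurable v := by fun_prop
  set B : ℝ → ℝ → ℂ := fun y => (Set.Ioi ((1 + a) * y)).indicator
    fun z => Complex.exp (d * y) * (v z : ℂ) with hB
  have hBm : Measurable (Function.uncurry B) := by
    have : Function.uncurry B = fun q : ℝ × ℝ =>
        if (1 + a) * q.1 < q.2 then Complex.exp (d * q.1) * (v q.2 : ℂ) else 0 := by
      funext q
      simp [Function.uncurry, hB, Set.indicator]
    rw [this]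
    exact Measurable.ite (measurableSet_lt (by fun_prop) (by fun_prop)) (by fun_prop)
      measurable_const
  have hsub : ∀ y : ℝ, 0 < y → Set.Ioi (0 : ℝ) ∩ Set.Ioi ((1 + a) * y) = Set.Ioi ((1 + a) * y) :=
    fun y hy => Set.inter_eq_right.2 (Set.Ioi_subset_Ioi (by positivity))
  have hdre : d.re = mu * (1 + a) - s.re := by simp [hd]
  have hBy : ∀ y : ℝ, 0 < y → ∫ z in Set.Ioi (0 : ℝ), B y z
      = Complex.exp (-s * y) * ((∫ c, f ((1 + a) * y + c) ∂(expMeasure mu) : ℝ) : ℂ) := by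
    intro y hy
    rw [setIntegral_indicator measurableSet_Ioi, hsub y hy, integral_expMeasure hmu,
      ← integral_complex_ofReal, ← integral_const_mul, ← setIntegral_Ioi_comp_sub _ ((1 + a) * y)]
    refine setIntegral_congr_fun measurableSet_Ioi fun z _ => ?_
    have e1 : Complex.exp (d * y) * Complex.exp (-mu * z)
        = Complex.exp (-s * y) * Complex.exp (-mu * (z - (1 + a) * y)) := by
      rw [← Complex.exp_add, ← Complex.exp_add, hd]
      ring_nf
    simp only [hv]
    push_cast
    rw [add_sub_cancel]
    linear_combination (mu : ℂ) * (f z : ℂ) * e1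
  have hnorm : ∀ y z : ℝ, ‖B y z‖ ≤ (Set.Ioi ((1 + a) * y)).indicator
      (fun z => Real.exp (d.re * y) * mu * Real.exp (-mu * z)) z := by
    intro y z
    simp only [hB, Set.indicator]
    split_ifs
    · rw [norm_mul, Complex.norm_real, Real.norm_of_nonneg (hv0 z), Complex.norm_exp, mul_assoc]
      simp only [Complex.mul_re, Complex.ofReal_re, Complex.ofReal_im, mul_zero, sub_zero]
      exact mul_le_mul_of_nonneg_left (hv1 z) (Real.exp_pos _).le
    · simp
  have hbi : ∀ y : ℝ, Integrable ((Set.Ioi ((1 + a) * y)).indicator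
      (fun z => Real.exp (d.re * y) * mu * Real.exp (-mu * z)))
      (volume.restrict (Set.Ioi (0 : ℝ))) := fun y =>
    ((exp_neg_integrableOn_Ioi 0 hmu).const_mul _).indicator measurableSet_Ioi
  -- Integrating the bound over `z` leaves `exp (Re d · y) exp (-μ (1 + a) y) = exp (-Re s · y)`, so
  -- the sign of `Re d` is irrelevant.
  have hint : Integrable (Function.uncurry B)
      ((volume.restrict (Set.Ioi (0 : ℝ))).prod (volume.restrict (Set.Ioi (0 : ℝ)))) := by
    rw [integrable_prod_iff hBm.aestronglyMeasurable]
    refine ⟨Eventually.of_forall fun y => (hbi y).mono'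
      (hBm.comp measurable_prodMk_left).aestronglyMeasurable (Eventually.of_forall (hnorm y)), ?_⟩
    refine Integrable.mono' (exp_neg_integrableOn_Ioi 0 hs)
      hBm.norm.stronglyMeasurable.integral_prod_right.aestronglyMeasurable ?_
    filter_upwards [ae_restrict_mem measurableSet_Ioi] with y hy
    rw [Real.norm_of_nonneg (integral_nonneg fun z => norm_nonneg _)]
    refine (integral_mono_of_nonneg (Eventually.of_forall fun z => norm_nonneg _) (hbi y)
      (Eventually.of_forall (hnorm y))).trans_eq ?_
    rw [setIntegral_indicator measurableSet_Ioi, hsub y hy, integral_const_mul,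
      integral_exp_mul_Ioi (neg_lt_zero.2 hmu), neg_div_neg_eq, mul_assoc,
      mul_div_cancel₀ _ hmu.ne', ← Real.exp_add, hdre]
    ring_nf
  have hswap := integral_integral_swap hint
  have hl : laplace (fun y => ∫ c, f ((1 + a) * y + c) ∂(expMeasure mu)) s
      = ∫ y in Set.Ioi (0 : ℝ), ∫ z in Set.Ioi (0 : ℝ), B y z :=
    setIntegral_congr_fun measurableSet_Ioi fun y hy => (hBy y hy).symm
  have hmure : 0 < (mu : ℂ).re := by simpa using hmu
  have hsre : 0 < (s / (1 + a)).re := by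
    have : (1 + a : ℂ) = ((1 + a : ℝ) : ℂ) := by push_cast; rfl
    rw [this, Complex.div_ofReal_re]
    positivity
  rw [hl, hswap, laplace, laplace, ← integral_sub (integrableOn_laplace hf h0 h1 hsre)
    (integrableOn_laplace hf h0 h1 hmure), ← integral_const_mul]
  refine setIntegral_congr_fun measurableSet_Ioi fun z hz => ?_
  have hz' : (0 : ℝ) ≤ z / (1 + a) := div_nonneg (le_of_lt hz) ha'.le
  have e1 : ∀ y : ℝ, B y z = (Set.Iio (z / (1 + a))).indicator
      (fun y : ℝ => Complex.exp (d * y) * (v z : ℂ)) y := by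
    intro y
    simp only [hB, Set.indicator, Set.mem_Ioi, Set.mem_Iio, lt_div_iff₀ ha', mul_comm (1 + a) y]
  simp only [e1]
  rw [setIntegral_indicator measurableSet_Iio, Set.Ioi_inter_Iio, integral_mul_const,
    setIntegral_Ioo_exp hd0 hz']
  have e2 : Complex.exp (d * ((z / (1 + a) : ℝ) : ℂ)) * Complex.exp (-mu * z)
      = Complex.exp (-(s / (1 + a)) * z) := by
    rw [← Complex.exp_add, hd]
    congr 1
    push_cast
    field_simp
    ring
  simp only [hv, ← e2]
  push_cast
  field_simp

/-! ### The functional equation -/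

theorem re_div_one_add_pow (a : ℝ) (s : ℂ) (k : ℕ) :
    (s / (1 + a) ^ k).re = s.re / (1 + a) ^ k := by
  have : ((1 + a : ℂ) ^ k) = (((1 + a) ^ k : ℝ) : ℂ) := by push_cast; rfl
  rw [this, Complex.div_ofReal_re]

theorem laplace_ruinTransform {F : Measure ℝ} [IsProbabilityMeasure F] (hF : ∀ᵐ t ∂F, 0 < t)
    {a mu α : ℝ} [IsProbabilityMeasure (expMeasure mu)] (ha : 0 < a) (hmu : 0 < mu) (hα : 0 ≤ α)
    {s : ℂ} (hs : 0 < s.re) (hne : s ≠ mu * (1 + a)) :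
    laplace (ruinTransform F (expMeasure mu) a α) s =
      H₁ F a mu (laplace (ruinTransform F (expMeasure mu) a α) mu) s α
        + J₁ F a mu s α * laplace (ruinTransform F (expMeasure mu) a α) (s / (1 + a)) := by
  have hG := ae_expMeasure_pos mu
  set f := ruinTransform F (expMeasure mu) a α with hf
  have hfm : Measurable f := measurable_ruinTransform hF hG ha hα
  have hf0 : ∀ x, 0 ≤ f x := ruinTransform_nonneg
  have hf1 : ∀ x, f x ≤ 1 := ruinTransform_le_one hF hG ha hα
  -- Averaging over the gain first separates the two integrations: `laplace_renewal` handles the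
  -- arrival and `laplace_exponential` the gain.
  set k : ℝ → ℝ := fun y => ∫ c, f ((1 + a) * y + c) ∂(expMeasure mu) with hk
  have hint : ∀ y, Integrable (fun c => f ((1 + a) * y + c)) (expMeasure mu) := fun y =>
    Integrable.of_bound (Measurable.aestronglyMeasurable (by fun_prop)) 1
      (Eventually.of_forall fun c => by rw [Real.norm_of_nonneg (hf0 _)]; exact hf1 _)
  have hkm : Measurable k := by
    have : Measurable (Function.uncurry fun y c : ℝ => f ((1 + a) * y + c)) :=
      hfm.comp (by fun_prop)
    exact this.stronglyMeasurable.integral_prod_right.measurable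
  have hk0 : ∀ y, 0 ≤ k y := fun y => integral_nonneg fun c => hf0 _
  have hk1 : ∀ y, k y ≤ 1 := fun y => by
    have := integral_mono (hint y) (integrable_const 1) fun c => hf1 ((1 + a) * y + c)
    simpa using this
  have hren : ∀ x, 0 < x → f x = ∫ t, (if x < t then Real.exp (-α * x) else
      Real.exp (-α * t) * k (x - t)) ∂F := by
    intro x hx
    rw [hf, ruinTransform_renewal hF hG ha hα hx, integral_prod]
    · refine integral_congr_ae (Eventually.of_forall fun t => ?_)
      simp only
      split_ifs
      · simp
      · rw [integral_const_mul]
    · refine Integrable.of_bound (Measurable.aestronglyMeasurable ?_) 1 ?_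
      · exact Measurable.ite (measurableSet_lt (by fun_prop) (by fun_prop)) (by fun_prop)
          (Measurable.mul (by fun_prop) (hfm.comp (by fun_prop)))
      · filter_upwards [ae_prod_pos hF hG] with q hq
        split_ifs
        · rw [Real.norm_of_nonneg (Real.exp_pos _).le]
          exact Real.exp_le_one_iff.2 (by nlinarith)
        · rw [Real.norm_of_nonneg (mul_nonneg (Real.exp_pos _).le (hf0 _))]
          exact mul_le_one₀ (Real.exp_le_one_iff.2 (by nlinarith [hq.1])) (hf0 _) (hf1 _)
  have h1 : laplace f s = (1 - lst F (s + α)) / (s + α) + lst F (s + α) * laplace k s := by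
    rw [← laplace_renewal hF hα hkm hk0 hk1 hs]
    refine setIntegral_congr_fun measurableSet_Ioi fun x hx => ?_
    simp only [← hren x hx]
  rw [h1, hk, laplace_exponential ha hmu hfm hf0 hf1 hs hne, H₁, J₁]
  ring

theorem ne_of_forall_ne {a mu : ℝ} (ha : 0 < a) {s : ℂ}
    (hs : ∀ j : ℕ, s ≠ mu * (1 + a) ^ (j + 1)) (k : ℕ) : s / (1 + a) ^ k ≠ mu * (1 + a) := by
  have hac : (1 + a : ℂ) ≠ 0 := by
    have : (1 + a : ℝ) ≠ 0 := by linarith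
    exact_mod_cast this
  intro h
  apply hs k
  rw [div_eq_iff (pow_ne_zero k hac)] at h
  rw [h]
  ring

theorem sum_seriesTerm {F : Measure ℝ} [IsProbabilityMeasure F] (hF : ∀ᵐ t ∂F, 0 < t)
    {a mu α : ℝ} [IsProbabilityMeasure (expMeasure mu)] (ha : 0 < a) (hmu : 0 < mu) (hα : 0 ≤ α)
    {s : ℂ} (hs : 0 < s.re) (hne : ∀ j : ℕ, s ≠ mu * (1 + a) ^ (j + 1)) (n : ℕ) :
    ∑ k ∈ Finset.range n, seriesTerm F a mu
        (laplace (ruinTransform F (expMeasure mu) a α) mu) s α k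
      = laplace (ruinTransform F (expMeasure mu) a α) s - prodJ₁ F a mu s α n
        * laplace (ruinTransform F (expMeasure mu) a α) (s / (1 + a) ^ n) := by
  induction n with
  | zero => simp [prodJ₁]
  | succ n ih =>
    have hre : 0 < (s / (1 + a) ^ n).re := by
      rw [re_div_one_add_pow]
      positivity
    have h := laplace_ruinTransform hF ha hmu hα hre (ne_of_forall_ne ha hne n)
    rw [Finset.sum_range_succ, ih, seriesTerm, h, prodJ₁, prodJ₁, Finset.prod_range_succ,
      div_div, ← pow_succ]
    ring

/-! ### Bounds for the Laplace-Stieltjes transform -/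

section lst

variable {F : Measure ℝ} [IsProbabilityMeasure F]

theorem integrable_exp_neg_mul (hF : ∀ᵐ t ∂F, 0 < t) {σ : ℝ} (hσ : 0 ≤ σ) :
    Integrable (fun t => Real.exp (-σ * t)) F := by
  refine Integrable.of_bound (by fun_prop) 1 ?_
  filter_upwards [hF] with t ht
  rw [Real.norm_of_nonneg (Real.exp_pos _).le]
  exact Real.exp_le_one_iff.2 (by nlinarith)

theorem realLst_pos (hF : ∀ᵐ t ∂F, 0 < t) {σ : ℝ} (hσ : 0 ≤ σ) : 0 < realLst F σ :=
  integral_exp_pos (integrable_exp_neg_mul hF hσ)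

theorem norm_lst_le (hF : ∀ᵐ t ∂F, 0 < t) {z : ℂ} {σ : ℝ} (hσ : 0 ≤ σ) (hz : σ ≤ z.re) :
    ‖lst F z‖ ≤ realLst F σ := by
  refine norm_integral_le_of_norm_le (integrable_exp_neg_mul hF hσ) ?_
  filter_upwards [hF] with t ht
  rw [norm_exp_neg_mul_ofReal]
  exact Real.exp_le_exp.2 (by nlinarith)

/-- Both quotients are integrals over `[0, t]`, of `exp (-z x)` and of `exp (-σ x)`. Keeping the
numerator `1 - exp (-σ t)` is what later makes the bounds telescope. -/
theorem norm_one_sub_exp_div_le {z : ℂ} {σ t : ℝ} (hσ : 0 < σ) (hz : σ ≤ z.re) (ht : 0 ≤ t) :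
    ‖(1 - Complex.exp (-z * t)) / z‖ ≤ (1 - Real.exp (-σ * t)) / σ := by
  have hz0 : z ≠ 0 := by
    rintro rfl
    simp at hz
    linarith
  have h1 : (1 - Complex.exp (-z * t)) / z = ∫ x in (0 : ℝ)..t, Complex.exp (-z * x) := by
    rw [integral_exp_mul_complex (neg_ne_zero.2 hz0)]
    simp only [Complex.ofReal_zero, mul_zero, Complex.exp_zero]
    rw [div_neg, ← neg_div, neg_sub]
  have h2 : (1 - Real.exp (-σ * t)) / σ = ∫ x in (0 : ℝ)..t, Real.exp (-σ * x) := by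
    have := intervalIntegral.integral_comp_mul_left (a := 0) (b := t) Real.exp
      (neg_ne_zero.2 hσ.ne')
    rw [this, integral_exp]
    simp only [mul_zero, Real.exp_zero, smul_eq_mul]
    field_simp
    ring
  rw [h1, h2]
  refine intervalIntegral.norm_integral_le_of_norm_le ht ?_
    (Continuous.intervalIntegrable (by fun_prop) _ _)
  refine Eventually.of_forall fun x hx => ?_
  rw [norm_exp_neg_mul_ofReal]
  exact Real.exp_le_exp.2 (by nlinarith [hx.1])

theorem norm_one_sub_lst_div_le (hF : ∀ᵐ t ∂F, 0 < t) {z : ℂ} {σ : ℝ} (hσ : 0 < σ)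
    (hz : σ ≤ z.re) : ‖(1 - lst F z) / z‖ ≤ (1 - realLst F σ) / σ := by
  have hi := integrable_exp_neg_mul hF hσ.le
  have hic : Integrable (fun t : ℝ => Complex.exp (-z * t)) F := by
    refine hi.mono' (Measurable.aestronglyMeasurable (by fun_prop)) ?_
    filter_upwards [hF] with t ht
    rw [norm_exp_neg_mul_ofReal]
    exact Real.exp_le_exp.2 (by nlinarith)
  have h1 : (1 - lst F z) / z = ∫ t : ℝ, (1 - Complex.exp (-z * t)) / z ∂F := by
    rw [integral_div, integral_sub (integrable_const 1) hic]
    simp [lst]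
  have h2 : (1 - realLst F σ) / σ = ∫ t, (1 - Real.exp (-σ * t)) / σ ∂F := by
    rw [integral_div, integral_sub (integrable_const 1) hi]
    simp [realLst]
  rw [h1, h2]
  refine norm_integral_le_of_norm_le (((integrable_const 1).sub hi).div_const σ) ?_
  filter_upwards [hF] with t ht using norm_one_sub_exp_div_le hσ hz ht.le

end lst

theorem lst_ofReal (F : Measure ℝ) (σ : ℝ) : lst F σ = (realLst F σ : ℂ) := by
  rw [lst, realLst, ← integral_complex_ofReal]
  refine integral_congr_ae (Eventually.of_forall fun t => ?_)
  push_cast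
  rfl

/-! ### Bounds for the products -/

/-- The product of the transforms `realLst F` along a geometric sequence. -/
def prodLst (F : Measure ℝ) (a σ : ℝ) (n : ℕ) : ℝ :=
  ∏ j ∈ Finset.range n, realLst F (σ / (1 + a) ^ j)

section prodLst

variable {F : Measure ℝ} [IsProbabilityMeasure F] {a σ : ℝ}

theorem prodLst_pos (hF : ∀ᵐ t ∂F, 0 < t) (ha : 0 < a) (hσ : 0 < σ) (n : ℕ) :
    0 < prodLst F a σ n :=
  Finset.prod_pos fun j _ => realLst_pos hF (by positivity)

theorem prodLst_succ (F : Measure ℝ) (a σ : ℝ) (n : ℕ) :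
    prodLst F a σ (n + 1) = prodLst F a σ n * realLst F (σ / (1 + a) ^ n) :=
  Finset.prod_range_succ _ _

theorem antitone_prodLst (hF : ∀ᵐ t ∂F, 0 < t) (ha : 0 < a) (hσ : 0 < σ) :
    Antitone (prodLst F a σ) := by
  refine antitone_nat_of_succ_le fun n => ?_
  rw [prodLst_succ]
  exact mul_le_of_le_one_right (prodLst_pos hF ha hσ n).le
    (realLst_lt_one hF (by positivity)).le

/-- The terms are the differences of consecutive products, so the sum telescopes whether or not the
products tend to `0`. -/
theorem summable_prodLst_mul (hF : ∀ᵐ t ∂F, 0 < t) (ha : 0 < a) (hσ : 0 < σ) :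
    Summable fun n => prodLst F a σ n * (1 - realLst F (σ / (1 + a) ^ n)) := by
  refine summable_of_sum_range_le (c := 1) (fun n => ?_) fun n => ?_
  · exact mul_nonneg (prodLst_pos hF ha hσ n).le
      (sub_nonneg.2 (realLst_lt_one hF (by positivity)).le)
  · have : ∑ i ∈ Finset.range n, prodLst F a σ i * (1 - realLst F (σ / (1 + a) ^ i))
        = 1 - prodLst F a σ n := by
      induction n with
      | zero => simp [prodLst]
      | succ n ih => rw [Finset.sum_range_succ, ih, prodLst_succ]; ring
    rw [this]
    linarith [prodLst_pos hF ha hσ n]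

end prodLst

theorem one_add_pow_tendsto {a : ℝ} (ha : 0 < a) (c : ℝ) :
    Tendsto (fun n : ℕ => c / (1 + a) ^ n) atTop (𝓝 0) :=
  tendsto_const_nhds.div_atTop (tendsto_pow_atTop_atTop_of_one_lt (by linarith))

/-- The rational factors of the products are geometrically small. -/
theorem exists_norm_prod_le {a mu : ℝ} (ha : 0 < a) (hmu : 0 < mu) {s : ℂ}
    (hne : ∀ j : ℕ, s ≠ mu * (1 + a) ^ (j + 1)) :
    ∃ K : ℝ, 0 < K ∧ ∀ n : ℕ,
      ‖∏ j ∈ Finset.range n, ((mu : ℂ) / (mu * (1 + a) - s / (1 + a) ^ j))‖ ≤ K / (1 + a) ^ n := by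
  have ha' : 0 < 1 + a := by linarith
  have hac : (1 + a : ℂ) ≠ 0 := by exact_mod_cast ha'.ne'
  have hmc : (mu : ℂ) ≠ 0 := by exact_mod_cast hmu.ne'
  set d : ℕ → ℂ := fun j => mu * (1 + a) - s / (1 + a) ^ j with hd
  have hd0 : ∀ j, d j ≠ 0 := fun j => sub_ne_zero.2 (ne_of_forall_ne ha hne j).symm
  set w : ℕ → ℂ := fun j => s / (1 + a) ^ j / d j with hw
  have hcast : ∀ n : ℕ, ‖s / (1 + a) ^ n‖ = ‖s‖ / (1 + a) ^ n := by
    intro n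
    have : ((1 + a : ℂ) ^ n) = (((1 + a) ^ n : ℝ) : ℂ) := by push_cast; rfl
    rw [norm_div, this, Complex.norm_real, Real.norm_of_nonneg (by positivity)]
  have hwsum : Summable fun j => ‖w j‖ := by
    have hlim : Tendsto (fun j => s / (1 + a : ℂ) ^ j) atTop (𝓝 0) := by
      rw [tendsto_zero_iff_norm_tendsto_zero]
      simp only [hcast]
      exact one_add_pow_tendsto ha _
    have hdlim : Tendsto d atTop (𝓝 (mu * (1 + a))) := by
      simpa using (tendsto_const_nhds (x := (mu : ℂ) * (1 + a))).sub hlim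
    have hinv := (hdlim.inv₀ (mul_ne_zero hmc hac)).isBigO_one ℝ
    have hgeo : Summable fun j : ℕ => ‖s‖ * (1 / (1 + a)) ^ j :=
      (summable_geometric_of_lt_one (by positivity)
        ((div_lt_one ha').2 (by linarith))).mul_left _
    refine summable_of_isBigO_nat hgeo (Asymptotics.IsBigO.norm_left ?_)
    have h1 : (fun j => s / (1 + a : ℂ) ^ j) =O[atTop] fun j : ℕ => ‖s‖ * (1 / (1 + a)) ^ j := by
      refine Asymptotics.IsBigO.of_bound 1 (Eventually.of_forall fun j => ?_)
      rw [hcast, one_mul, Real.norm_of_nonneg (by positivity), one_div, inv_pow, div_eq_mul_inv]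
    simpa [hw, div_eq_mul_inv] using h1.mul hinv
  refine ⟨Real.exp (∑' j, ‖w j‖), Real.exp_pos _, fun n => ?_⟩
  -- `1 + w j = μ (1 + a) / d j`: each factor is `1 / (1 + a)` up to a summable relative
  -- perturbation.
  have hfac : ∀ j, (mu : ℂ) / d j = (1 + w j) * (1 / (1 + a)) := by
    intro j
    have e : s / (1 + a) ^ j = mu * (1 + a) - d j := by simp [hd]
    simp only [hw, e]
    field_simp [hd0 j]
    ring
  rw [Finset.prod_congr rfl fun j _ => hfac j, Finset.prod_mul_distrib, norm_mul,
    Finset.prod_const, Finset.card_range, norm_pow, norm_prod]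
  have e1 : ‖(1 / (1 + a) : ℂ)‖ = 1 / (1 + a) := by
    have : (1 / (1 + a) : ℂ) = ((1 / (1 + a) : ℝ) : ℂ) := by push_cast; rfl
    rw [this, Complex.norm_real, Real.norm_of_nonneg (by positivity)]
  rw [e1, one_div, inv_pow, ← div_eq_mul_inv]
  gcongr
  calc ∏ j ∈ Finset.range n, ‖1 + w j‖ ≤ ∏ j ∈ Finset.range n, (1 + ‖w j‖) :=
        Finset.prod_le_prod (fun _ _ => norm_nonneg _) fun j _ =>
          (norm_add_le _ _).trans_eq (by simp)
    _ ≤ Real.exp (∑ j ∈ Finset.range n, ‖w j‖) :=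
        Real.prod_one_add_le_exp_sum _ fun j => norm_nonneg _
    _ ≤ _ := Real.exp_le_exp.2 (hwsum.sum_le_tsum _ fun _ _ => norm_nonneg _)

section series

variable {F : Measure ℝ} [IsProbabilityMeasure F]

theorem exists_norm_prodJ₁_le (hF : ∀ᵐ t ∂F, 0 < t) {a mu α : ℝ} (ha : 0 < a) (hmu : 0 < mu)
    (hα : 0 ≤ α) {s : ℂ} (hs : 0 < s.re) (hne : ∀ j : ℕ, s ≠ mu * (1 + a) ^ (j + 1)) :
    ∃ K : ℝ, 0 < K ∧ ∀ n : ℕ, ‖prodJ₁ F a mu s α n‖ ≤ K / (1 + a) ^ n * prodLst F a s.re n := by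
  obtain ⟨K, hK0, hK⟩ := exists_norm_prod_le ha hmu hne
  refine ⟨K, hK0, fun n => ?_⟩
  simp only [prodJ₁, J₁]
  rw [Finset.prod_mul_distrib, norm_mul, mul_comm]
  refine mul_le_mul (hK n) ?_ (norm_nonneg _) (by positivity)
  rw [norm_prod]
  refine Finset.prod_le_prod (fun _ _ => norm_nonneg _) fun j _ => ?_
  refine norm_lst_le hF (by positivity) ?_
  rw [Complex.add_re, re_div_one_add_pow, Complex.ofReal_re]
  linarith

theorem summable_prodJ₁_succ (hF : ∀ᵐ t ∂F, 0 < t) {a mu α : ℝ} (ha : 0 < a) (hmu : 0 < mu)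
    (hα : 0 ≤ α) {s : ℂ} (hs : 0 < s.re) (hne : ∀ j : ℕ, s ≠ mu * (1 + a) ^ (j + 1)) :
    Summable fun n => prodJ₁ F a mu s α (n + 1) := by
  obtain ⟨K, hK0, hK⟩ := exists_norm_prodJ₁_le hF ha hmu hα hs hne
  have hgeo : Summable fun j : ℕ => K * (1 / (1 + a)) ^ j :=
    (summable_geometric_of_lt_one (by positivity)
      ((div_lt_one (by linarith)).2 (by linarith))).mul_left _
  have h : Summable (prodJ₁ F a mu s α) := by
    refine Summable.of_norm_bounded hgeo fun n => (hK n).trans ?_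
    rw [one_div, inv_pow, ← div_eq_mul_inv]
    refine mul_le_of_le_one_right (by positivity) ?_
    simpa [prodLst] using antitone_prodLst hF ha hs (Nat.zero_le n)
  exact (summable_nat_add_iff 1).2 h

/-- The bound on the quotient brings a factor `(1 + a) ^ n`, which uses up the geometric decay of
the product; the telescoping series remains. -/
theorem summable_prodJ₁_mul (hF : ∀ᵐ t ∂F, 0 < t) {a mu α : ℝ} (ha : 0 < a) (hmu : 0 < mu)
    (hα : 0 ≤ α) {s : ℂ} (hs : 0 < s.re) (hne : ∀ j : ℕ, s ≠ mu * (1 + a) ^ (j + 1)) :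
    Summable fun n => prodJ₁ F a mu s α n
      * ((1 - lst F (s / (1 + a) ^ n + α)) / (s / (1 + a) ^ n + α)) := by
  obtain ⟨K, hK0, hK⟩ := exists_norm_prodJ₁_le hF ha hmu hα hs hne
  refine Summable.of_norm_bounded ((summable_prodLst_mul hF ha hs).mul_left (K / s.re))
    fun n => ?_
  have hσ : 0 < s.re / (1 + a) ^ n := by positivity
  rw [norm_mul]
  refine (mul_le_mul (hK n) (norm_one_sub_lst_div_le hF hσ ?_) (norm_nonneg _)
    (mul_nonneg (by positivity) (prodLst_pos hF ha hs n).le)).trans_eq ?_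
  · rw [Complex.add_re, re_div_one_add_pow, Complex.ofReal_re]
    linarith
  · field_simp

/-- The coefficient of `m` in `H₁` is `-J₁`, which extends the product by one factor. -/
theorem seriesTerm_eq (F : Measure ℝ) (a mu : ℝ) (m s : ℂ) (α : ℝ) (k : ℕ) :
    seriesTerm F a mu m s α k = prodJ₁ F a mu s α k
        * ((1 - lst F (s / (1 + a) ^ k + α)) / (s / (1 + a) ^ k + α))
      - m * prodJ₁ F a mu s α (k + 1) := by
  rw [seriesTerm, H₁, prodJ₁, prodJ₁, Finset.prod_range_succ, J₁]
  ring

/-! ### The remainder -/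

theorem norm_laplace_le {f : ℝ → ℝ} (h0 : ∀ x, 0 ≤ f x) {s : ℂ} (hs : 0 < s.re) {b t : ℝ}
    (ht : 0 ≤ t)
    (hf : ∀ x, 0 < x → f x ≤ b + Real.exp (-t * x)) :
    ‖laplace f s‖ ≤ b / s.re + 1 / (s.re + t) := by
  have hst : 0 < s.re + t := by linarith
  have h1 : IntegrableOn (fun x => b * Real.exp (-s.re * x) + Real.exp (-(s.re + t) * x))
      (Set.Ioi 0) :=
    ((exp_neg_integrableOn_Ioi 0 hs).const_mul b).add (exp_neg_integrableOn_Ioi 0 hst)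
  refine (norm_integral_le_of_norm_le h1 ?_).trans_eq ?_
  · filter_upwards [ae_restrict_mem measurableSet_Ioi] with x hx
    rw [norm_mul, norm_exp_neg_mul_ofReal, Complex.norm_real, Real.norm_of_nonneg (h0 x)]
    refine (mul_le_mul_of_nonneg_left (hf x hx) (Real.exp_pos _).le).trans_eq ?_
    rw [mul_add, ← Real.exp_add]
    ring_nf
  · rw [integral_add ((exp_neg_integrableOn_Ioi 0 hs).const_mul b)
      (exp_neg_integrableOn_Ioi 0 hst), integral_const_mul,
      integral_exp_mul_Ioi (neg_lt_zero.2 hs), integral_exp_mul_Ioi (neg_lt_zero.2 hst)]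
    simp only [mul_zero, Real.exp_zero, neg_div_neg_eq, mul_one_div]

theorem tendsto_remainder (hF : ∀ᵐ t ∂F, 0 < t) {a mu α : ℝ}
    [IsProbabilityMeasure (expMeasure mu)] (ha : 0 < a) (hmu : 0 < mu) (hα : 0 ≤ α)
    {s : ℂ} (hs : 0 < s.re) (hne : ∀ j : ℕ, s ≠ mu * (1 + a) ^ (j + 1)) :
    Tendsto (fun n => prodJ₁ F a mu s α n
        * laplace (ruinTransform F (expMeasure mu) a α) (s / (1 + a) ^ n)) atTop (𝓝 0) := by
  have hG := ae_expMeasure_pos mu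
  obtain ⟨K, hK0, hK⟩ := exists_norm_prodJ₁_le hF ha hmu hα hs hne
  set f := ruinTransform F (expMeasure mu) a α
  have hf0 : ∀ x, 0 ≤ f x := ruinTransform_nonneg
  have hf1 : ∀ x, f x ≤ 1 := ruinTransform_le_one hF hG ha hα
  set σ := s.re
  set Φ := prodLst F a σ
  have hΦpos : ∀ n, 0 < Φ n := prodLst_pos hF ha hs
  have hΦanti : Antitone Φ := antitone_prodLst hF ha hs
  have hre : ∀ n : ℕ, (s / (1 + a) ^ n).re = σ / (1 + a) ^ n := re_div_one_add_pow a s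
  have hσn : ∀ n : ℕ, 0 < σ / (1 + a) ^ n := fun n => by positivity
  -- Normalised so that the remainder is at most `K / σ * (Φ n * r n)`.
  set r : ℕ → ℝ := fun n => σ / (1 + a) ^ n * ‖laplace f (s / (1 + a) ^ n)‖ with hr
  have hr0 : ∀ n, 0 ≤ r n := fun n => mul_nonneg (hσn n).le (norm_nonneg _)
  have hrb : ∀ (n : ℕ) (b t : ℝ), 0 ≤ t → (∀ x, 0 < x → f x ≤ b + Real.exp (-t * x)) →
      r n ≤ b + σ / (1 + a) ^ n / (σ / (1 + a) ^ n + t) := by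
    intro n b t ht hft
    have h := norm_laplace_le hf0 (by rw [hre]; exact hσn n) ht hft
    rw [hre] at h
    refine (mul_le_mul_of_nonneg_left h (hσn n).le).trans_eq ?_
    rw [mul_add, mul_div_cancel₀ _ (hσn n).ne', mul_one_div]
  have hmain : Tendsto (fun n => Φ n * r n) atTop (𝓝 0) := by
    obtain ⟨l, hl⟩ : ∃ l, Tendsto Φ atTop (𝓝 l) :=
      ⟨_, tendsto_atTop_ciInf hΦanti ⟨0, by rintro _ ⟨n, rfl⟩; exact (hΦpos n).le⟩⟩
    have hlb : ∀ n, l ≤ Φ n := fun n => hΦanti.le_of_tendsto hl n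
    have hl0 : 0 ≤ l := ge_of_tendsto' hl fun n => (hΦpos n).le
    rcases hl0.eq_or_lt with rfl | hlpos
    -- If `Φ` tends to `0`, the trivial bound `r n ≤ 1` suffices.
    · refine squeeze_zero (fun n => mul_nonneg (hΦpos n).le (hr0 n)) (fun n => ?_) hl
      refine mul_le_of_le_one_right (hΦpos n).le ?_
      have := hrb n 0 0 le_rfl fun x _ => by simpa using hf1 x
      rwa [add_zero, zero_add, div_self (hσn n).ne'] at this
    · have hr1 : Tendsto r atTop (𝓝 0) := by
        rw [Metric.tendsto_atTop]
        intro ε hε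
        have hlim1 : Tendsto (fun m => 1 - l / Φ m) atTop (𝓝 0) := by
          have := (tendsto_const_nhds (x := (1 : ℝ))).sub
            ((tendsto_const_nhds (x := l)).div hl hlpos.ne')
          rwa [div_self hlpos.ne', sub_self] at this
        obtain ⟨m, hm⟩ := (hlim1.eventually (gt_mem_nhds (half_pos hε))).exists
        -- With `t = σ / (1 + a) ^ m` the products in `ruinTransform_le` are the tails `Φ (m + n) /
        -- Φ m ≥ l / Φ m`. The choice of `m` makes the constant part less than `ε / 2`; the
        -- exponential part contributes less than `ε / 2` for large `n`.
        have hft : ∀ x, 0 < x → f x ≤ 1 - l / Φ m + Real.exp (-(σ / (1 + a) ^ m) * x) := by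
          intro x hx
          refine ruinTransform_le hF hG ha hα (hσn m) (fun n => ?_) hx
          rw [div_le_iff₀' (hΦpos m)]
          refine (hlb (m + n)).trans_eq ?_
          show prodLst F a σ (m + n) = prodLst F a σ m * _
          rw [prodLst, Finset.prod_range_add, prodLst]
          simp only [div_div, pow_add]
        have hlim2 : Tendsto (fun n : ℕ => σ / (1 + a) ^ n / (σ / (1 + a) ^ n + σ / (1 + a) ^ m))
            atTop (𝓝 0) := by
          have h := (one_add_pow_tendsto ha σ).div
            ((one_add_pow_tendsto ha σ).add_const (σ / (1 + a) ^ m))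
            (by rw [zero_add]; exact (hσn m).ne')
          rwa [zero_div] at h
        obtain ⟨N, hN⟩ := eventually_atTop.1 (hlim2.eventually (gt_mem_nhds (half_pos hε)))
        refine ⟨N, fun n hn => ?_⟩
        rw [Real.dist_eq, sub_zero, abs_of_nonneg (hr0 n)]
        linarith [hrb n _ _ (hσn m).le hft, hN n hn]
      simpa using hl.mul hr1
  rw [tendsto_zero_iff_norm_tendsto_zero]
  refine squeeze_zero (fun n => norm_nonneg _) (fun n => ?_)
    (by simpa using hmain.const_mul (K / σ))
  rw [norm_mul]
  refine (mul_le_mul_of_nonneg_right (hK n) (norm_nonneg _)).trans_eq ?_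
  simp only [hr]
  field_simp

theorem hasSum_seriesTerm (hF : ∀ᵐ t ∂F, 0 < t) {a mu α : ℝ}
    [IsProbabilityMeasure (expMeasure mu)] (ha : 0 < a) (hmu : 0 < mu) (hα : 0 ≤ α)
    {s : ℂ} (hs : 0 < s.re) (hne : ∀ j : ℕ, s ≠ mu * (1 + a) ^ (j + 1)) :
    HasSum (seriesTerm F a mu (laplace (ruinTransform F (expMeasure mu) a α) mu) s α)
      (laplace (ruinTransform F (expMeasure mu) a α) s) := by
  have hsum : Summable
      (seriesTerm F a mu (laplace (ruinTransform F (expMeasure mu) a α) mu) s α) := by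
    simp only [funext (seriesTerm_eq F a mu _ s α)]
    exact (summable_prodJ₁_mul hF ha hmu hα hs hne).sub
      ((summable_prodJ₁_succ hF ha hmu hα hs hne).mul_left _)
  rw [hsum.hasSum_iff_tendsto_nat]
  simp only [sum_seriesTerm hF ha hmu hα hs hne]
  simpa using (tendsto_const_nhds
    (x := laplace (ruinTransform F (expMeasure mu) a α) s)).sub
    (tendsto_remainder hF ha hmu hα hs hne)

end series

/-! ### The model on an arbitrary probability space -/

section model

variable {Ω : Type*} [MeasurableSpace Ω] {P : Measure Ω}
  {F G : Measure ℝ} [IsProbabilityMeasure F] [IsProbabilityMeasure G] {A C : ℕ → Ω → ℝ}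

/-- Joint independence of all interarrival times and gains makes the law of the path a product
measure, so expectations can be computed on path space. -/
theorem hasLaw_path (hA : ∀ i, HasLaw (A i) F P) (hC : ∀ i, HasLaw (C i) G P)
    (hindep : iIndepFun (fun i : ℕ ⊕ ℕ => Sum.elim A C i) P) :
    HasLaw (fun ω (i : ℕ ⊕ ℕ) => Sum.elim A C i ω) (pathLaw F G) P := by
  have h : ∀ i : ℕ ⊕ ℕ, HasLaw (Sum.elim A C i) (marginal F G i) P := by
    rintro (i | i)
    · exact hA i
    · exact hC i
  exact hindep.hasLaw_infinitePi h (aemeasurable_pi_iff.2 fun i => (h i).aemeasurable)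

variable {a α x : ℝ}

theorem integral_discountedRuin (hF : ∀ᵐ t ∂F, 0 < t) (hG : ∀ᵐ c ∂G, 0 < c) (ha : 0 < a)
    (hA : ∀ i, HasLaw (A i) F P) (hC : ∀ i, HasLaw (C i) G P)
    (hindep : iIndepFun (fun i : ℕ ⊕ ℕ => Sum.elim A C i) P) (hx : 0 < x) :
    ∫ ω, discountedRuin a A C α x ω ∂P = ruinTransform F G a α x := by
  rw [ruinTransform, if_pos hx, ← (hasLaw_path hA hC hindep).integral_comp
    (aestronglyMeasurable_discount_ruinTime hF hG ha hx)]
  rfl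

theorem integrable_discountedRuin (hF : ∀ᵐ t ∂F, 0 < t) (hG : ∀ᵐ c ∂G, 0 < c) (ha : 0 < a)
    (hα : 0 ≤ α) [IsFiniteMeasure P] (hA : ∀ i, HasLaw (A i) F P) (hC : ∀ i, HasLaw (C i) G P)
    (hindep : iIndepFun (fun i : ℕ ⊕ ℕ => Sum.elim A C i) P) (hx : 0 < x) :
    Integrable (discountedRuin a A C α x) P := by
  have hlaw := hasLaw_path hA hC hindep
  have hm := aestronglyMeasurable_discount_ruinTime (α := α) hF hG ha hx
  rw [← hlaw.map_eq] at hm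
  refine Integrable.of_bound (hm.comp_aemeasurable hlaw.aemeasurable) 1
    (Eventually.of_forall fun ω => ?_)
  rw [discountedRuin, discount]
  split_ifs
  · simp
  · rw [Real.norm_of_nonneg (Real.exp_pos _).le, Real.exp_le_one_iff]
    exact mul_nonpos_of_nonpos_of_nonneg (by linarith) ENNReal.toReal_nonneg

end model

/-! ### The singularities of the terms -/

section singularities

variable {a mu : ℝ}

theorem mean_ne (ha : 0 < a) (hmu : 0 < mu) (j : ℕ) : (mu : ℂ) ≠ mu * (1 + a) ^ (j + 1) := by
  have h : mu ≠ mu * (1 + a) ^ (j + 1) := by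
    have h1 : 1 < (1 + a) ^ (j + 1) := one_lt_pow₀ (by linarith) (by omega)
    nlinarith
  exact_mod_cast h

theorem re_singularity_pos (ha : 0 < a) (hmu : 0 < mu) (j : ℕ) :
    0 < ((mu : ℂ) * (1 + a) ^ (j + 1)).re := by
  have h : (mu : ℂ) * (1 + a) ^ (j + 1) = ((mu * (1 + a) ^ (j + 1) : ℝ) : ℂ) := by push_cast; rfl
  rw [h, Complex.ofReal_re]
  positivity

/-- Distinct singularities are therefore at least `μ a` apart, and a punctured ball of this radius
around one contains no other. -/
theorem le_pow_sub_pow (ha : 0 < a) {i j : ℕ} (hij : i < j) :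
    a ≤ (1 + a) ^ (j + 1) - (1 + a) ^ (i + 1) := by
  have h1 : (1 + a) ^ (i + 2) ≤ (1 + a) ^ (j + 1) := pow_le_pow_right₀ (by linarith) (by omega)
  have h2 : 1 ≤ (1 + a) ^ (i + 1) := one_le_pow₀ (by linarith)
  have h3 : (1 + a) ^ (i + 2) = (1 + a) ^ (i + 1) * (1 + a) := pow_succ _ _
  nlinarith

theorem eventually_ne_singularity (ha : 0 < a) (hmu : 0 < mu) (j : ℕ) :
    ∀ᶠ s : ℂ in 𝓝[≠] ((mu : ℂ) * (1 + a) ^ (j + 1)),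
      ∀ i : ℕ, s ≠ mu * (1 + a) ^ (i + 1) := by
  filter_upwards [self_mem_nhdsWithin, nhdsWithin_le_nhds
    (Metric.ball_mem_nhds ((mu : ℂ) * (1 + a) ^ (j + 1)) (mul_pos hmu ha))] with s hne hs i hi
  have hij : i ≠ j := by
    rintro rfl
    exact hne hi
  have h : (mu : ℂ) * (1 + a) ^ (i + 1) - mu * (1 + a) ^ (j + 1)
      = ((mu * ((1 + a) ^ (i + 1) - (1 + a) ^ (j + 1)) : ℝ) : ℂ) := by
    push_cast
    ring
  rw [Metric.mem_ball, dist_eq_norm, hi, h, Complex.norm_real, Real.norm_eq_abs, abs_mul,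
    abs_of_pos hmu] at hs
  have hlt := lt_of_mul_lt_mul_left hs hmu.le
  rcases lt_or_gt_of_ne hij with hij | hij
  · rw [abs_sub_comm] at hlt
    linarith [le_pow_sub_pow ha hij, le_abs_self ((1 + a) ^ (j + 1) - (1 + a) ^ (i + 1))]
  · linarith [le_pow_sub_pow ha hij, le_abs_self ((1 + a) ^ (i + 1) - (1 + a) ^ (j + 1))]

end singularities

theorem continuousAt_laplace {f : ℝ → ℝ} (hf : Measurable f) (h0 : ∀ x, 0 ≤ f x)
    (h1 : ∀ x, f x ≤ 1) {s : ℂ} (hs : 0 < s.re) : ContinuousAt (laplace f) s := by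
  refine continuousAt_of_dominated (bound := fun x => Real.exp (-(s.re / 2) * x))
    (Eventually.of_forall fun z => Measurable.aestronglyMeasurable (by fun_prop)) ?_
    (exp_neg_integrableOn_Ioi 0 (half_pos hs)) (Eventually.of_forall fun x => by fun_prop)
  filter_upwards [(Complex.continuous_re.tendsto s).eventually
    (lt_mem_nhds (half_lt_self hs))] with z hz
  filter_upwards [ae_restrict_mem measurableSet_Ioi] with x hx
  rw [norm_mul, norm_exp_neg_mul_ofReal, Complex.norm_real, Real.norm_of_nonneg (h0 x)]
  refine (mul_le_of_le_one_right (Real.exp_pos _).le (h1 x)).trans (Real.exp_le_exp.2 ?_)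
  have : (0 : ℝ) < x := hx
  nlinarith

/-! ### The denominator -/

/-- At `s = μ / (1 + a) ^ k` the rational factor of `J₁` is `(1 + a) ^ k / ((1 + a) ^ (k + 1) - 1)`.
-/
theorem denTerm_eq (F : Measure ℝ) {a mu : ℝ} (ha : 0 < a) (hmu : 0 < mu) (α : ℝ) (k : ℕ) :
    denTerm F a mu α k = prodJ₁ F a mu mu α (k + 1) := by
  have hac : (1 + a : ℂ) ≠ 0 := by
    have : (1 + a : ℝ) ≠ 0 := by linarith
    exact_mod_cast this
  have hmc : (mu : ℂ) ≠ 0 := by exact_mod_cast hmu.ne'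
  have hpc : (1 + a : ℂ) ^ k ≠ 0 := pow_ne_zero k hac
  have hq : (1 + a : ℂ) ^ (k + 1) - 1 ≠ 0 := by
    have h1 : (1 + a) ^ (k + 1) - 1 ≠ 0 :=
      (sub_pos.2 (one_lt_pow₀ (by linarith : 1 < 1 + a) (by omega))).ne'
    exact_mod_cast h1
  have hd : (mu : ℂ) * (1 + a) - mu / (1 + a) ^ k
      = mu * ((1 + a) ^ (k + 1) - 1) / (1 + a) ^ k := by
    field_simp
    ring
  have e : (mu : ℂ) / (mu * (1 + a) - mu / (1 + a) ^ k)
      = (1 + a) ^ k / ((1 + a) ^ (k + 1) - 1) := by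
    rw [hd]
    field_simp
  simp only [denTerm, prodJ₁]
  rw [Finset.prod_range_succ, J₁.eq_1 F a mu (mu / (1 + a) ^ k), e]
  ring

/-- Since `μ / (1 + a) ^ j ≤ μ < μ (1 + a)`, every factor `J₁` is real and nonnegative, so the
denominator has real part at least `1`. -/
theorem one_add_tsum_denTerm_ne_zero (F : Measure ℝ) {a mu : ℝ} (ha : 0 < a) (hmu : 0 < mu)
    (α : ℝ) (hsum : Summable (denTerm F a mu α)) : 1 + ∑' k, denTerm F a mu α k ≠ 0 := by
  have hJ : ∀ j : ℕ, ∃ r : ℝ, 0 ≤ r ∧ J₁ F a mu (mu / (1 + a) ^ j) α = r := by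
    intro j
    refine ⟨realLst F (mu / (1 + a) ^ j + α) * (mu / (mu * (1 + a) - mu / (1 + a) ^ j)), ?_, ?_⟩
    · refine mul_nonneg (realLst_nonneg _ _) (div_nonneg hmu.le (sub_nonneg.2 ?_))
      have h1 : 1 ≤ (1 + a) ^ j := one_le_pow₀ (by linarith)
      have h2 : mu / (1 + a) ^ j ≤ mu := div_le_self hmu.le h1
      nlinarith
    · rw [J₁]
      push_cast
      rw [← lst_ofReal]
      push_cast
      rfl
  choose r hr0 hr using hJ
  have hre : ∀ k, 0 ≤ (denTerm F a mu α k).re := by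
    intro k
    rw [denTerm_eq F ha hmu, prodJ₁, Finset.prod_congr rfl fun j _ => hr j, ← Complex.ofReal_prod,
      Complex.ofReal_re]
    exact Finset.prod_nonneg fun j _ => hr0 j
  intro h
  have h2 := congrArg Complex.re h
  rw [Complex.add_re, Complex.one_re, Complex.re_tsum hsum, Complex.zero_re] at h2
  have h3 : 0 ≤ ∑' k, (denTerm F a mu α k).re := tsum_nonneg hre
  linarith

end DualRisk

end

/-! ### The double transform on the given probability space -/

theorem theorem2 {Ω : Type*} [MeasurableSpace Ω] (P : Measure Ω) [IsProbabilityMeasure P]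
    (a mu : ℝ) (ha : 0 < a) (hmu : 0 < mu)
    -- the interarrival distribution, on the positive half-line and with a density
    (F : Measure ℝ) (hFpos : F (Set.Iic 0) = 0) (hFdens : F ≪ volume)
    -- the interarrival times and the additive gains
    (A C : ℕ → Ω → ℝ)
    (hA : ∀ i, HasLaw (A i) F P)
    (hC : ∀ i, HasLaw (C i) (expMeasure mu) P)
    (hindep : iIndepFun (fun i : ℕ ⊕ ℕ => Sum.elim A C i) P)
    (α : ℝ) (hα : 0 ≤ α) :
    -- the transforms are well defined
    (∀ x : ℝ, 0 < x → Integrable (DualRisk.discountedRuin a A C α x) P) ∧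
    (∀ s : ℂ, 0 < s.re → IntegrableOn
      (fun x : ℝ => Complex.exp (-s * x)
        * ((∫ ω, DualRisk.discountedRuin a A C α x ω ∂P : ℝ) : ℂ)) (Set.Ioi 0)) ∧
    -- the series for the double transform, off the singularities of its terms
    (∀ s : ℂ, 0 < s.re → (∀ j : ℕ, s ≠ mu * (1 + a) ^ (j + 1)) →
      HasSum (DualRisk.seriesTerm F a mu (DualRisk.tau P a A C mu α) s α)
        (DualRisk.tau P a A C s α)) ∧
    -- these singularities are removable
    (∀ j : ℕ, Tendsto
      (fun s : ℂ => ∑' k, DualRisk.seriesTerm F a mu (DualRisk.tau P a A C mu α) s α k)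
      (𝓝[≠] ((mu : ℂ) * (1 + a) ^ (j + 1)))
      (𝓝 (DualRisk.tau P a A C ((mu : ℂ) * (1 + a) ^ (j + 1)) α))) ∧
    -- the value of `τ(μ, α)`
    Summable (DualRisk.numTerm F a mu α) ∧
    Summable (DualRisk.denTerm F a mu α) ∧
    1 + ∑' k, DualRisk.denTerm F a mu α k ≠ 0 ∧
    DualRisk.tau P a A C mu α =
      (∑' k, DualRisk.numTerm F a mu α k) / (1 + ∑' k, DualRisk.denTerm F a mu α k) := by
  have hFprob : IsProbabilityMeasure F := (hA 0).isProbabilityMeasure_iff.1 inferInstance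
  have hGprob : IsProbabilityMeasure (expMeasure mu) := isProbabilityMeasure_expMeasure hmu
  have hF : ∀ᵐ t ∂F, 0 < t := by
    rw [ae_iff]
    exact measure_mono_null (fun t ht => not_lt.1 ht) hFpos
  have hG := DualRisk.ae_expMeasure_pos mu
  have hmure : 0 < (mu : ℂ).re := by simpa using hmu
  have hmune := DualRisk.mean_ne ha hmu
  set f := DualRisk.ruinTransform F (expMeasure mu) a α with hf
  have hfm : Measurable f := DualRisk.measurable_ruinTransform hF hG ha hα
  have hf0 : ∀ x, 0 ≤ f x := DualRisk.ruinTransform_nonneg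
  have hf1 : ∀ x, f x ≤ 1 := DualRisk.ruinTransform_le_one hF hG ha hα
  have hfx : ∀ x : ℝ, 0 < x → ∫ ω, DualRisk.discountedRuin a A C α x ω ∂P = f x :=
    fun x hx => DualRisk.integral_discountedRuin hF hG ha hA hC hindep hx
  have htau : ∀ s, DualRisk.tau P a A C s α = DualRisk.laplace f s := fun s =>
    setIntegral_congr_fun measurableSet_Ioi fun x hx => by
      simp only [hfx x hx]
  have hseries : ∀ s : ℂ, 0 < s.re → (∀ j : ℕ, s ≠ mu * (1 + a) ^ (j + 1)) →
      HasSum (DualRisk.seriesTerm F a mu (DualRisk.laplace f mu) s α) (DualRisk.laplace f s) :=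
    fun s hs hne => DualRisk.hasSum_seriesTerm hF ha hmu hα hs hne
  have hnum : Summable (DualRisk.numTerm F a mu α) :=
    DualRisk.summable_prodJ₁_mul hF ha hmu hα hmure hmune
  have hden' : DualRisk.denTerm F a mu α = fun k => DualRisk.prodJ₁ F a mu mu α (k + 1) :=
    funext (DualRisk.denTerm_eq F ha hmu α)
  have hden : Summable (DualRisk.denTerm F a mu α) := by
    rw [hden']
    exact DualRisk.summable_prodJ₁_succ hF ha hmu hα hmure hmune
  have hden0 := DualRisk.one_add_tsum_denTerm_ne_zero F ha hmu α hden
  simp only [htau]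
  refine ⟨fun x hx => DualRisk.integrable_discountedRuin hF hG ha hα hA hC hindep hx,
    fun s hs => ?_, hseries, fun j => ?_, hnum, hden, hden0, ?_⟩
  · refine (DualRisk.integrableOn_laplace hfm hf0 hf1 hs).congr_fun (fun x hx => ?_)
      measurableSet_Ioi
    simp only [hfx x hx]
  -- Near the singularity the series equals the transform, which is continuous there.
  · have hp := DualRisk.re_singularity_pos ha hmu j
    refine ((DualRisk.continuousAt_laplace hfm hf0 hf1 hp).tendsto.mono_left
      nhdsWithin_le_nhds).congr' ?_
    filter_upwards [nhdsWithin_le_nhds ((Complex.continuous_re.tendsto _).eventually (lt_mem_nhds hp)),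
      DualRisk.eventually_ne_singularity ha hmu j] with s hs hne
    exact (hseries s hs hne).tsum_eq.symm
  -- `μ` is not a singular point, and the series at `s = μ` reads `τ(μ) = N - τ(μ) D`, with `N` and
  -- `D` the sums of `numTerm` and `denTerm`.
  · have h := (hseries mu hmure hmune).tsum_eq
    have hterm : ∀ k, DualRisk.seriesTerm F a mu (DualRisk.laplace f mu) mu α k
        = DualRisk.numTerm F a mu α k - DualRisk.laplace f mu * DualRisk.denTerm F a mu α k := by
      intro k
      rw [DualRisk.seriesTerm_eq, DualRisk.denTerm_eq F ha hmu, DualRisk.numTerm]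
    simp only [hterm] at h
    rw [hnum.tsum_sub (hden.mul_left _), tsum_mul_left] at h
    rw [eq_div_iff hden0]
    linear_combination -h
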